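/- **Setting.** An instance of the multi-vehicle non-preemptive dial-a-ride problem consists of a finite set $V$ of locations with a function $w:V\times V\to\mathbb R$ satisfying $w(a,a)=0$, $w(a,b)=w(b,a)$ and $w(a,c)\le w(a,b)+w(b,c)$ (distinct locations may have distance $0$), $m$ requests $(s_j,t_j)\in V\times V$, $h\ge 1$ vehicles with initial locations $o_1,\dots,o_h\in V$, and a common capacity $\lambda\ge 1$. A solution assigns to each vehicle $i$ a walk that starts at $o_i$ and need not return. Along the walks every request $j$ is picked up (at $s_j$) exactly once and is afterwards delivered (at $t_j$) exactly once, by the same vehicle, and no vehicle ever carries more than $\lambda$ items. $\mathrm{OPT}$ is the infimum of the total weight of the walks over all solutions. **Alg.1.** (1) Let $H$ be the complete graph with vertices $k_1,\dots,k_h$ (depots) and $l_1,\dots,l_m$ and weights $\widetilde w(k_i,k_j)=2w(o_i,o_j)$, $\widetilde w(k_i,l_j)=w(o_i,s_j)+w(o_i,t_j)$, $\widetilde w(l_i,l_j)=w(s_i,s_j)+w(t_i,t_j)$. Compute a family $\mathcal T$ of closed tours in $H$ such that every vertex lies on exactly one tour and every tour contains exactly one depot, with total weight at most twice the minimum. (2)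 For each depot $k_i$, let $k_i\,l_{j_1}\cdots l_{j_r}$ be its tour. If $r\le\lambda$, vehicle $i$ picks up $j_1,\dots,j_r$ and then delivers $j_1,\dots,j_r$, in this order. If $r>\lambda$, draw $\theta_i$ uniformly from $\{1,\dots,\lambda\}$ (independently for different $i$) and cut $j_1,\dots,j_r$ into the fragment of the first $\theta_i$ requests, followed by fragments of $\lambda$ requests each, the last one possibly shorter; vehicle $i$ serves the fragments one after the other, each by picking up all its requests and then delivering all of them, both in the order of the fragment. **Theorem.** For the multi-vehicle non-preemptive dial-a-ride problem, Alg.1 is an $O(\sqrt\lambda\,\log m)$-approximation algorithm with running time $O(m^2)$. Precisely: 1. There is an absolute constant $C$ such that for every instance, and for every 2-approximate family $\mathcal T$ used in step (1), the routes formed in step (2) are a feasible solution for every choice of the offsets $\theta_i\in\{1,\dots,\lambda\}$, and their expected total weight over the random offsets is at most $C\,\sqrt{\lambda}\,\log(m+1)\cdot\mathrm{OPT}$. 2. There is one program for a random access machine (cells with natural numbers and with real numbers; unit-cost addition, subtraction, comparison, indirect addressing, lookup of $w$, and drawing of independent uniform elements of $\{1,\dots,\lambda\}$) that carries out Alg.1.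 On every instance with $m\geq 1$ and $h=O(m)$ there is a 2-approximate family $\mathcal T$, not depending on the random draws, such that, for all outcomes of the draws, the program halts after $O(m^2)$ steps and its output is the set of routes that step (2) forms from $\mathcal T$ and the drawn offsets. Here, for every $\kappa$, the constant in $O(m^2)$ can be chosen uniformly for all instances with $h\le\kappa m$. -/

import Mathlib

open scoped BigOperators

namespace MDaRP

/-! ### Walks and tours -/

/-- The weight of the walk `v₁ v₂ … v_r`, that is `d v₁ v₂ + d v₂ v₃ + … + d v_{r-1} v_r`. -/
def walkWeight {α : Type*} (d : α → α → ℝ) : List α → ℝ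
  | x :: y :: l => d x y + walkWeight d (y :: l)
  | _ => 0

/-- The weight of the tour `v₁ v₂ … v_r`: the walk together with the closing edge `v_r v₁`. -/
def tourWeight {α : Type*} (d : α → α → ℝ) : List α → ℝ
  | [] => 0
  | x :: l => walkWeight d (x :: (l ++ [x]))

/-! ### The multi-vehicle non-preemptive dial-a-ride problem -/

/-- An instance: a finite metric `w` on `n` locations (distinct locations may have distance zero),
`m` requests with sources `src j` and destinations `dst j`, and `h ≥ 1` vehicles of common capacity
`cap ≥ 1` with initial locations `depot i`. -/
structure Instance where
  n : ℕ
  h : ℕ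
  m : ℕ
  cap : ℕ
  w : Fin n → Fin n → ℝ
  src : Fin m → Fin n
  dst : Fin m → Fin n
  depot : Fin h → Fin n
  w_self : ∀ a, w a a = 0
  w_symm : ∀ a b, w a b = w b a
  w_triangle : ∀ a b c, w a c ≤ w a b + w b c
  h_pos : 0 < h
  cap_pos : 0 < cap

/-- One entry of a route: passing through a location, picking up the item of a request at its
source, or delivering the item of a request at its destination. -/
inductive Stop (n m : ℕ) where
  | visit (v : Fin n)
  | pickup (j : Fin m)
  | deliver (j : Fin m)
  deriving DecidableEq

def Stop.isPickup {n m : ℕ} : Stop n m → Bool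
  | .pickup _ => true
  | _ => false

def Stop.isDelivery {n m : ℕ} : Stop n m → Bool
  | .deliver _ => true
  | _ => false

namespace Instance

variable (I : Instance)

/-- The location at which a stop takes place. -/
def loc : Stop I.n I.m → Fin I.n
  | .visit v => v
  | .pickup j => I.src j
  | .deliver j => I.dst j

/-- A family of routes, one (possibly empty) route per vehicle. -/
abbrev Routes : Type := Fin I.h → List (Stop I.n I.m)

/-- The total weight of the routes. Vehicle `i` starts at `depot i` and need not return. -/
noncomputable def weight (R : I.Routes) : ℝ :=
  ∑ i, walkWeight I.w (I.depot i :: (R i).map I.loc)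

/-- Feasible non-preemptive solutions. -/
structure IsFeasible (R : I.Routes) : Prop where
  /-- every item is picked up exactly once, by exactly one vehicle -/
  pickup_once : ∀ j, ∑ i, (R i).count (.pickup j) = 1
  /-- it is delivered exactly once, by the vehicle that picked it up -/
  same_vehicle : ∀ i j, (R i).count (.deliver j) = (R i).count (.pickup j)
  /-- it is delivered only after it was picked up -/
  order : ∀ i j p, p <+: R i → p.count (.deliver j) ≤ p.count (.pickup j)
  /-- at every moment at most `cap` items are on board -/
  capacity : ∀ i p, p <+: R i → p.countP Stop.isPickup ≤ p.countP Stop.isDelivery + I.cap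

/-- The weight of an optimal solution. -/
noncomputable def opt : ℝ := sInf {x | ∃ R : I.Routes, I.IsFeasible R ∧ I.weight R = x}

/-! ### The graph `H` and the multi-depot TSP in it -/

/-- The weight function of the complete graph `H`, which has one vertex `Sum.inl i` for every vehicle
(these are the depots) and one vertex `Sum.inr j` for every request. -/
def wH : Fin I.h ⊕ Fin I.m → Fin I.h ⊕ Fin I.m → ℝ
  | .inl i, .inl i' => 2 * I.w (I.depot i) (I.depot i')
  | .inl i, .inr j => I.w (I.depot i) (I.src j) + I.w (I.depot i) (I.dst j)
  | .inr j, .inl i => I.w (I.depot i) (I.src j) + I.w (I.depot i) (I.dst j)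
  | .inr j, .inr j' => I.w (I.src j) (I.src j') + I.w (I.dst j) (I.dst j')

/-- A family of tours in `H`, one for every depot. `T i` lists the request vertices of the tour
through depot `i`, in the order of the tour, which is read off starting from the depot. -/
abbrev Tours : Type := Fin I.h → List (Fin I.m)

/-- `T` is a solution of the multi-depot TSP in `H`: every request vertex lies in exactly one of the
tours, and there exactly once. (Every tour contains exactly one depot by construction.) -/
def IsMTSP (T : I.Tours) : Prop := ∀ j, ∑ i, (T i).count j = 1

/-- The weight of a family of tours in `H`. -/
noncomputable def mtspWeight (T : I.Tours) : ℝ :=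
  ∑ i, tourWeight I.wH (Sum.inl i :: (T i).map Sum.inr)

/-- `T` is a 2-approximate solution of the multi-depot TSP in `H`. -/
def IsTwoApproxMTSP (T : I.Tours) : Prop :=
  I.IsMTSP T ∧ ∀ S : I.Tours, I.IsMTSP S → I.mtspWeight T ≤ 2 * I.mtspWeight S

/-! ### The algorithm -/

/-- Cutting the request sequence `L` of a tour: the first fragment has the first `θ` requests, the
next ones have `c` requests each, and the last one has the remaining ones. There are
`⌈(L.length - θ) / c⌉ + 1` fragments. -/
def fragments (c θ : ℕ) {α : Type*} (L : List α) : List (List α) :=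
  L.take θ :: (List.range ((L.length - θ) ⌈/⌉ c)).map fun k => (L.drop (θ + c * k)).take c

/-- Serve the requests of a fragment: visit all its sources, then all its destinations, both in the
order of the fragment. -/
def serve (B : List (Fin I.m)) : List (Stop I.n I.m) :=
  B.map Stop.pickup ++ B.map Stop.deliver

/-- The routes that the algorithm forms from the tours `T` in `H` and the offsets `θ`. A tour with at
most `cap` requests is not cut. -/
def algRoutes (T : I.Tours) (θ : Fin I.h → ℕ) : I.Routes := fun i =>
  if (T i).length ≤ I.cap then I.serve (T i)
  else (fragments I.cap (θ i) (T i)).flatMap I.serve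

/-- The expected weight of the routes when the offsets are independent and uniform in
`{1, …, cap}`. -/
noncomputable def algExpectedWeight (T : I.Tours) : ℝ :=
  𝔼 θ : Fin I.h → Fin I.cap, I.weight (I.algRoutes T fun i => (θ i : ℕ) + 1)

end Instance

/-! ### A random access machine over the reals, with unit costs

The memory consists of arrays of natural numbers and arrays of real numbers. A program names finitely
many of them; cells are addressed by computed indices. Natural numbers can only be added, subtracted
(truncated at zero) and compared, real numbers can only be added, subtracted and compared. The
distance table of the instance is read-only. Every operation costs one step. -/

inductive NExp where
  | const (k : ℕ)
  | read (a : ℕ) (i : NExp)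
  | add (e f : NExp)
  | sub (e f : NExp)

inductive RExp where
  | read (a : ℕ) (i : NExp)
  | dist (u v : NExp)
  | add (e f : RExp)
  | sub (e f : RExp)

inductive Test where
  | ltN (e f : NExp)
  | ltR (e f : RExp)
  | neg (b : Test)
  | conj (b c : Test)

inductive Cmd where
  | skip
  /-- `natArray a [i] := e` -/
  | setN (a : ℕ) (i e : NExp)
  /-- `realArray a [i] := e` -/
  | setR (a : ℕ) (i : NExp) (e : RExp)
  /-- `natArray a [i] :=` the next number on the random tape -/
  | draw (a : ℕ) (i : NExp)
  | seq (p q : Cmd)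
  | ite (b : Test) (p q : Cmd)
  | loop (b : Test) (p : Cmd)

structure State where
  nat : ℕ → ℕ → ℕ
  real : ℕ → ℕ → ℝ
  tape : ℕ → ℕ

namespace State

def writeN (s : State) (a i x : ℕ) : State :=
  { s with nat := Function.update s.nat a (Function.update (s.nat a) i x) }

noncomputable def writeR (s : State) (a i : ℕ) (x : ℝ) : State :=
  { s with real := Function.update s.real a (Function.update (s.real a) i x) }

def popTape (s : State) : State := { s with tape := fun k => s.tape (k + 1) }

end State

namespace NExp

def eval (s : State) : NExp → ℕ
  | const k => k
  | read a i => s.nat a (i.eval s)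
  | add e f => e.eval s + f.eval s
  | sub e f => e.eval s - f.eval s

def cost : NExp → ℕ
  | const _ => 1
  | read _ i => i.cost + 1
  | add e f => e.cost + f.cost + 1
  | sub e f => e.cost + f.cost + 1

end NExp

namespace RExp

/-- `D` is the distance table. -/
noncomputable def eval (D : ℕ → ℕ → ℝ) (s : State) : RExp → ℝ
  | read a i => s.real a (i.eval s)
  | dist u v => D (u.eval s) (v.eval s)
  | add e f => e.eval D s + f.eval D s
  | sub e f => e.eval D s - f.eval D s

def cost : RExp → ℕ
  | read _ i => i.cost + 1
  | dist u v => u.cost + v.cost + 1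
  | add e f => e.cost + f.cost + 1
  | sub e f => e.cost + f.cost + 1

end RExp

namespace Test

def Holds (D : ℕ → ℕ → ℝ) (s : State) : Test → Prop
  | ltN e f => e.eval s < f.eval s
  | ltR e f => e.eval D s < f.eval D s
  | neg b => ¬ b.Holds D s
  | conj b c => b.Holds D s ∧ c.Holds D s

def cost : Test → ℕ
  | ltN e f => e.cost + f.cost + 1
  | ltR e f => e.cost + f.cost + 1
  | neg b => b.cost + 1
  | conj b c => b.cost + c.cost + 1

end Test

/-- `Exec D p s s' t`: the program `p`, started in the state `s`, halts in the state `s'` after `t`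
steps. -/
inductive Exec (D : ℕ → ℕ → ℝ) : Cmd → State → State → ℕ → Prop where
  | skip (s : State) : Exec D .skip s s 1
  | setN (s : State) (a : ℕ) (i e : NExp) :
      Exec D (.setN a i e) s (s.writeN a (i.eval s) (e.eval s)) (i.cost + e.cost + 1)
  | setR (s : State) (a : ℕ) (i : NExp) (e : RExp) :
      Exec D (.setR a i e) s (s.writeR a (i.eval s) (e.eval D s)) (i.cost + e.cost + 1)
  | draw (s : State) (a : ℕ) (i : NExp) :
      Exec D (.draw a i) s ((s.writeN a (i.eval s) (s.tape 0)).popTape) (i.cost + 1)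
  | seq {p q : Cmd} {s₁ s₂ s₃ : State} {t u : ℕ} (hp : Exec D p s₁ s₂ t) (hq : Exec D q s₂ s₃ u) :
      Exec D (.seq p q) s₁ s₃ (t + u)
  | ite_true {b : Test} {p q : Cmd} {s s' : State} {t : ℕ} (hb : b.Holds D s)
      (hp : Exec D p s s' t) : Exec D (.ite b p q) s s' (b.cost + t + 1)
  | ite_false {b : Test} {p q : Cmd} {s s' : State} {t : ℕ} (hb : ¬ b.Holds D s)
      (hq : Exec D q s s' t) : Exec D (.ite b p q) s s' (b.cost + t + 1)
  | loop_done {b : Test} {p : Cmd} {s : State} (hb : ¬ b.Holds D s) :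
      Exec D (.loop b p) s s (b.cost + 1)
  | loop_step {b : Test} {p : Cmd} {s₁ s₂ s₃ : State} {t u : ℕ} (hb : b.Holds D s₁)
      (hp : Exec D p s₁ s₂ t) (hl : Exec D (.loop b p) s₂ s₃ u) :
      Exec D (.loop b p) s₁ s₃ (b.cost + t + u + 1)

/-- Executions are deterministic, given the random tape. -/
theorem Exec.det {D : ℕ → ℕ → ℝ} {p : Cmd} {s s₁ s₂ : State} {t₁ t₂ : ℕ}
    (e₁ : Exec D p s s₁ t₁) (e₂ : Exec D p s s₂ t₂) : s₁ = s₂ ∧ t₁ = t₂ := by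
  induction e₁ generalizing s₂ t₂ with
  | skip | setN | setR | draw => cases e₂; exact ⟨rfl, rfl⟩
  | seq _ _ ihp ihq =>
    cases e₂ with
    | seq hp hq =>
      obtain ⟨rfl, rfl⟩ := ihp hp
      obtain ⟨rfl, rfl⟩ := ihq hq
      exact ⟨rfl, rfl⟩
  | ite_true hb _ ih =>
    cases e₂ with
    | ite_true _ hp => obtain ⟨rfl, rfl⟩ := ih hp; exact ⟨rfl, rfl⟩
    | ite_false hn _ => exact absurd hb hn
  | ite_false hb _ ih =>
    cases e₂ with
    | ite_true hn _ => exact absurd hn hb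
    | ite_false _ hp => obtain ⟨rfl, rfl⟩ := ih hp; exact ⟨rfl, rfl⟩
  | loop_done hb =>
    cases e₂ with
    | loop_done => exact ⟨rfl, rfl⟩
    | loop_step hn => exact absurd hn hb
  | loop_step hb _ _ ihp ihl =>
    cases e₂ with
    | loop_done hn => exact absurd hb hn
    | loop_step _ hp hl =>
      obtain ⟨rfl, rfl⟩ := ihp hp
      obtain ⟨rfl, rfl⟩ := ihl hl
      exact ⟨rfl, rfl⟩

/-! ### Input and output of the machine -/

namespace Instance

variable (I : Instance)

/-- The distance table. -/
noncomputable def table (u v : ℕ) : ℝ :=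
  if hu : u < I.n then if hv : v < I.n then I.w ⟨u, hu⟩ ⟨v, hv⟩ else 0 else 0

/-- The initial state with random tape `ω`: array `0` holds `n, h, m, cap`, the arrays `1`, `2`, `3`
hold the sources, the destinations and the initial locations, all other cells are zero. -/
def initState (ω : ℕ → ℕ) : State where
  nat a k :=
    match a with
    | 0 => ([I.n, I.h, I.m, I.cap][k]?).getD 0
    | 1 => if hk : k < I.m then (I.src ⟨k, hk⟩ : ℕ) else 0
    | 2 => if hk : k < I.m then (I.dst ⟨k, hk⟩ : ℕ) else 0
    | 3 => if hk : k < I.h then (I.depot ⟨k, hk⟩ : ℕ) else 0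
    | _ => 0
  real _ _ := 0
  tape := ω

/-- The code of a stop, a positive number. -/
def code : Stop I.n I.m → ℕ
  | .visit v => 3 * v + 1
  | .pickup j => 3 * j + 2
  | .deliver j => 3 * j + 3

/-- Routes as a word: the codes of the stops of the vehicles' routes, one vehicle after the other,
every route being followed by the end marker `0`. -/
def encode (R : I.Routes) : List ℕ :=
  (List.finRange I.h).flatMap fun i => (R i).map I.code ++ [0]

/-- The state `s` holds the routes `R` as its output: the length of their encoding is the first entry
of array `4`, the encoding itself is at the beginning of array `5`. -/
def IsOutput (s : State) (R : I.Routes) : Prop :=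
  s.nat 4 0 = (I.encode R).length ∧
    ∀ k (hk : k < (I.encode R).length), s.nat 5 k = (I.encode R)[k]

end Instance

end MDaRP

/-!
*Light tours exist.* On the route of a vehicle in a feasible solution, a request is the interval
between the positions of the vehicle at its pickup and at its delivery, and every point lies in at
most `λ` of these intervals. Halve the requests at a median of the left end points. The intervals
that cover the median are at most `λ` points of a square. Cutting the square into about `√λ`
vertical strips with at most `√λ` points each orders them with `ℓ₁`-length `O(√λ)` times the side.
The other intervals lie to the left or to the right of the median and are ordered recursively, to
depth `O(log m)`. The `ℓ₁`-distance of two intervals bounds the weight of the edge between the two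
requests in `H`, so `H` has a family of tours of weight `O(√λ log m) · OPT`. Counting the requests
on board along the routes also gives `∑ j, w (s j) (t j) ≤ λ · OPT`.

*Light tours give light routes.* Serving the fragments costs at most twice the walk through them in
`H`, plus `2 w (s j) (t j)` for the last request `j` of every fragment. For the last request of a
tour, the two edges at the depot pay for this term. Any other request is last in its fragment with
probability at most `1 / λ`, so the remaining terms are at most `2 · OPT` in expectation.

*Quadratic time.* Prim's algorithm on `H`, started with all depots as roots, finds a forest that
weighs no more than any family of tours. A new request is inserted into a linked list directly
behind its nearest vertex, which costs at most twice the new edge by the triangle inequality.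
-/

namespace MDaRP

/-! ### Walks and tours -/

section Walk

variable {α β : Type*}

@[simp] theorem walkWeight_nil (d : α → α → ℝ) : walkWeight d [] = 0 := rfl

@[simp] theorem walkWeight_singleton (d : α → α → ℝ) (x : α) : walkWeight d [x] = 0 := rfl

@[simp] theorem walkWeight_cons_cons (d : α → α → ℝ) (x y : α) (l : List α) :
    walkWeight d (x :: y :: l) = d x y + walkWeight d (y :: l) := rfl

theorem walkWeight_append_cons (d : α → α → ℝ) (l₁ : List α) (x : α) (l₂ : List α) :
    walkWeight d (l₁ ++ x :: l₂) = walkWeight d (l₁ ++ [x]) + walkWeight d (x :: l₂) := by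
  induction l₁ with
  | nil => simp
  | cons a l ih =>
    cases l with
    | nil => simp
    | cons b l => simp only [List.cons_append, walkWeight_cons_cons] at ih ⊢; rw [ih, add_assoc]

theorem walkWeight_append_cons_cons (d : α → α → ℝ) (l₁ : List α) (x y : α) (l₂ : List α) :
    walkWeight d (l₁ ++ x :: y :: l₂) =
      walkWeight d (l₁ ++ [x]) + d x y + walkWeight d (y :: l₂) := by
  rw [walkWeight_append_cons, walkWeight_cons_cons, add_assoc]

theorem walkWeight_append (d : α → α → ℝ) {l₁ l₂ : List α} (h₁ : l₁ ≠ []) (h₂ : l₂ ≠ []) :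
    walkWeight d (l₁ ++ l₂) =
      walkWeight d l₁ + d (l₁.getLast h₁) (l₂.head h₂) + walkWeight d l₂ := by
  obtain ⟨l, a, rfl⟩ := (List.eq_nil_or_concat l₁).resolve_left h₁
  obtain ⟨b, r, rfl⟩ := List.exists_cons_of_ne_nil h₂
  simp [walkWeight_append_cons_cons]

theorem walkWeight_cons (d : α → α → ℝ) (x : α) {l : List α} (hl : l ≠ []) :
    walkWeight d (x :: l) = d x (l.head hl) + walkWeight d l := by
  obtain ⟨a, r, rfl⟩ := List.exists_cons_of_ne_nil hl
  rfl

theorem tourWeight_cons (d : α → α → ℝ) (x : α) {l : List α} (hl : l ≠ []) :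
    tourWeight d (x :: l) = d x (l.head hl) + walkWeight d l + d (l.getLast hl) x := by
  rw [tourWeight, ← List.cons_append, walkWeight_append d (by simp) (by simp),
    walkWeight_cons d x hl]
  simp [List.getLast_cons hl]

theorem walkWeight_map (d : α → α → ℝ) (f : β → α) (l : List β) :
    walkWeight d (l.map f) = walkWeight (fun a b => d (f a) (f b)) l := by
  induction l with
  | nil => rfl
  | cons a l ih =>
    cases l with
    | nil => rfl
    | cons b l => simpa using ih

theorem walkWeight_add (d d' : α → α → ℝ) (l : List α) :
    walkWeight (fun a b => d a b + d' a b) l = walkWeight d l + walkWeight d' l := by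
  induction l with
  | nil => simp
  | cons a l ih =>
    cases l with
    | nil => simp
    | cons b l => simp only [walkWeight_cons_cons, ih]; ring

theorem walkWeight_take_succ_succ (d : α → α → ℝ) (l : List α) {q : ℕ} (hq : q + 1 < l.length) :
    walkWeight d (l.take (q + 2)) = walkWeight d (l.take (q + 1)) + d l[q] l[q + 1] := by
  rw [← List.take_append_getElem hq, ← List.take_append_getElem (Nat.lt_of_succ_lt hq),
    List.append_assoc, List.singleton_append, walkWeight_append_cons_cons, walkWeight_singleton,
    add_zero]

variable {d : α → α → ℝ}

theorem walkWeight_nonneg (hd : ∀ a b, 0 ≤ d a b) (l : List α) : 0 ≤ walkWeight d l := by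
  induction l with
  | nil => simp
  | cons a l ih =>
    cases l with
    | nil => simp
    | cons b l => simpa using add_nonneg (hd a b) ih

theorem walkWeight_mono {d' : α → α → ℝ} {l : List α}
    (h : ∀ a ∈ l, ∀ b ∈ l, d a b ≤ d' a b) : walkWeight d l ≤ walkWeight d' l := by
  induction l with
  | nil => simp
  | cons a l ih =>
    cases l with
    | nil => simp
    | cons b l =>
      exact add_le_add (h _ (by simp) _ (by simp))
        (ih fun x hx y hy => h x (List.mem_cons_of_mem _ hx) y (List.mem_cons_of_mem _ hy))

theorem walkWeight_le_of_isPrefix (hd : ∀ a b, 0 ≤ d a b) {l₁ l₂ : List α} (h : l₁ <+: l₂) :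
    walkWeight d l₁ ≤ walkWeight d l₂ := by
  obtain ⟨l, rfl⟩ := h
  rcases List.eq_nil_or_concat l₁ with rfl | ⟨r, a, rfl⟩
  · exact walkWeight_nonneg hd _
  · rw [List.concat_eq_append, List.append_assoc, List.singleton_append,
      walkWeight_append_cons d r a l]
    exact le_add_of_nonneg_right (walkWeight_nonneg hd _)

theorem walkWeight_append_le {l₁ l₂ : List α} {D : ℝ} (hD : 0 ≤ D)
    (h : ∀ a ∈ l₁, ∀ b ∈ l₂, d a b ≤ D) :
    walkWeight d (l₁ ++ l₂) ≤ walkWeight d l₁ + walkWeight d l₂ + D := by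
  rcases l₂ with _ | ⟨b, l₂⟩
  · simpa using hD
  rcases List.eq_nil_or_concat l₁ with rfl | ⟨l, a, rfl⟩
  · simpa using hD
  · have hab := h a (by simp) b (by simp)
    rw [List.concat_eq_append, List.append_assoc, List.singleton_append,
      walkWeight_append_cons_cons]
    linarith

theorem walkWeight_append_append_le {l₁ l₂ l₃ : List α} {D : ℝ} (hD : 0 ≤ D)
    (h : ∀ a ∈ l₁ ++ l₂ ++ l₃, ∀ b ∈ l₁ ++ l₂ ++ l₃, d a b ≤ D) :
    walkWeight d (l₁ ++ l₂ ++ l₃) ≤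
      walkWeight d l₁ + walkWeight d l₂ + walkWeight d l₃ + 2 * D := by
  have h₁₂ := walkWeight_append_le (l₁ := l₁) (l₂ := l₂) hD fun a ha b hb =>
    h a (by simp [ha]) b (by simp [hb])
  have h₃ := walkWeight_append_le (l₁ := l₁ ++ l₂) (l₂ := l₃) hD fun a ha b hb =>
    h a (List.mem_append_left _ ha) b (by simp [hb])
  linarith

theorem walkWeight_le_length_mul {l : List α} {D : ℝ} (hD : 0 ≤ D)
    (h : ∀ a ∈ l, ∀ b ∈ l, d a b ≤ D) : walkWeight d l ≤ l.length * D := by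
  induction l with
  | nil => simp
  | cons a l ih =>
    have hl := ih fun x hx y hy => h x (List.mem_cons_of_mem _ hx) y (List.mem_cons_of_mem _ hy)
    cases l with
    | nil => simpa using hD
    | cons b l =>
      have hab := h a (by simp) b (by simp)
      simp only [walkWeight_cons_cons, List.length_cons, Nat.cast_add, Nat.cast_one] at hl ⊢
      linarith

theorem dist_getElem_le (h₀ : ∀ a, d a a = 0) (ht : ∀ a b c, d a c ≤ d a b + d b c)
    (l : List α) {p q : ℕ} (hpq : p ≤ q) (hq : q < l.length) :
    d l[p] l[q] ≤ walkWeight d (l.take (q + 1)) - walkWeight d (l.take (p + 1)) := by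
  induction q, hpq using Nat.le_induction with
  | base => simp [h₀]
  | succ q _ ih =>
    have htri := ht l[p] l[q] l[q + 1]
    have hstep := walkWeight_take_succ_succ d l hq
    linarith [ih (Nat.lt_of_succ_lt hq)]

theorem dist_head_getLast_le (h₀ : ∀ a, d a a = 0) (ht : ∀ a b c, d a c ≤ d a b + d b c)
    {l : List α} (hl : l ≠ []) : d (l.head hl) (l.getLast hl) ≤ walkWeight d l := by
  have hpos := List.length_pos_iff.2 hl
  have h := dist_getElem_le h₀ ht l (Nat.zero_le (l.length - 1)) (by omega)
  rwa [Nat.sub_add_cancel hpos, List.take_length, List.take_one, List.head?_eq_some_head hl,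
    Option.toList_some, walkWeight_singleton, sub_zero, ← List.head_eq_getElem,
    ← List.getLast_eq_getElem] at h

theorem tourWeight_cons_le {x : α} {l : List α} {D : ℝ} (hD : 0 ≤ D)
    (h : ∀ a ∈ x :: l, d x a ≤ D ∧ d a x ≤ D) :
    tourWeight d (x :: l) ≤ walkWeight d l + 2 * D := by
  have hopen : walkWeight d (l ++ [x]) ≤ walkWeight d l + D := by
    simpa using walkWeight_append_le (l₂ := [x]) hD fun a ha b hb => by
      rw [List.mem_singleton.1 hb]
      exact (h a (List.mem_cons_of_mem _ ha)).2
  have hclose : walkWeight d (x :: (l ++ [x])) ≤ walkWeight d (l ++ [x]) + D := by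
    simpa using walkWeight_append_le (l₁ := [x]) (l₂ := l ++ [x]) hD fun a ha b hb => by
      rw [List.mem_singleton.1 ha]
      exact (h b (by simpa [or_comm] using hb)).1
  rw [tourWeight]
  linarith

end Walk

/-! ### Short orders for points of the plane -/

section Strips

variable {ι κ : Type*} [LinearOrder κ]

theorem exists_perm_pairwise_le (g : ι → κ) (l : List ι) :
    ∃ l' : List ι, l'.Perm l ∧ l'.Pairwise fun i j => g i ≤ g j :=
  ⟨l.insertionSort (g ⁻¹'o (· ≤ ·)), List.perm_insertionSort _ _,
    List.pairwise_insertionSort (g ⁻¹'o (· ≤ ·)) _⟩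

theorem exists_mem_Icc_forall_take_drop {g : ι → κ} {l : List ι}
    (hl : l.Pairwise fun i j => g i ≤ g j) {a b : κ} (hab : a ≤ b)
    (h : ∀ i ∈ l, g i ∈ Set.Icc a b) (k : ℕ) :
    ∃ t ∈ Set.Icc a b, (∀ i ∈ l.take k, g i ∈ Set.Icc a t) ∧
      ∀ i ∈ l.drop k, g i ∈ Set.Icc t b := by
  have htake : ∀ i ∈ l.take k, g i ∈ Set.Icc a b := fun i hi => h i (List.mem_of_mem_take hi)
  have hdrop : ∀ i ∈ l.drop k, g i ∈ Set.Icc a b := fun i hi => h i (List.mem_of_mem_drop hi)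
  rw [← List.take_append_drop k l, List.pairwise_append] at hl
  obtain ⟨-, hsorted, hcross⟩ := hl
  rcases hr : l.drop k with _ | ⟨j, r⟩
  · exact ⟨b, ⟨hab, le_rfl⟩, htake, by simp⟩
  · rw [hr] at hdrop hsorted hcross
    refine ⟨g j, hdrop j (by simp), fun i hi => ⟨(htake i hi).1, hcross i hi j (by simp)⟩,
      fun i hi => ⟨?_, (hdrop i hi).2⟩⟩
    rcases List.mem_cons.1 hi with rfl | hi
    · exact le_rfl
    · exact List.rel_of_pairwise_cons hsorted hi

theorem walkWeight_abs_sub_le_of_pairwise {y : ι → ℝ} {l : List ι}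
    (hl : l.Pairwise fun i j => y i ≤ y j) {a b : ℝ} (hab : a ≤ b)
    (h : ∀ i ∈ l, y i ∈ Set.Icc a b) : walkWeight (fun i j => |y i - y j|) l ≤ b - a := by
  induction l generalizing a with
  | nil => simpa using hab
  | cons i l ih =>
    cases l with
    | nil => simpa using hab
    | cons j l =>
      obtain ⟨hi, htail⟩ := List.pairwise_cons.1 hl
      have hfrom : walkWeight (fun i j => |y i - y j|) (j :: l) ≤ b - y j := by
        refine ih htail (h j (by simp)).2 fun k hk => ⟨?_, (h k (List.mem_cons_of_mem _ hk)).2⟩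
        rcases List.mem_cons.1 hk with rfl | hk
        · exact le_rfl
        · exact List.rel_of_pairwise_cons htail hk
      have hij := hi j (by simp)
      rw [walkWeight_cons_cons, abs_of_nonpos (sub_nonpos.2 hij)]
      linarith [(h i (by simp)).1]

/-- The `ℓ₁`-distance of the points `(x i, y i)` and `(x j, y j)` of the plane. -/
def planeDist (x y : ι → ℝ) (i j : ι) : ℝ := |x i - x j| + |y i - y j|

theorem planeDist_le {x y : ι → ℝ} {a b c e : ℝ} {i j : ι} (hxi : x i ∈ Set.Icc a b)
    (hxj : x j ∈ Set.Icc a b) (hyi : y i ∈ Set.Icc c e) (hyj : y j ∈ Set.Icc c e) :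
    planeDist x y i j ≤ (b - a) + (e - c) :=
  add_le_add (Real.dist_le_of_mem_Icc hxi hxj) (Real.dist_le_of_mem_Icc hyi hyj)

theorem walkWeight_planeDist_le_of_pairwise {x y : ι → ℝ} {l : List ι}
    (hl : l.Pairwise fun i j => y i ≤ y j) {a b c e : ℝ} (hab : a ≤ b) (hce : c ≤ e)
    (hx : ∀ i ∈ l, x i ∈ Set.Icc a b) (hy : ∀ i ∈ l, y i ∈ Set.Icc c e) :
    walkWeight (planeDist x y) l ≤ l.length * (b - a) + (e - c) := by
  unfold planeDist
  rw [walkWeight_add]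
  exact add_le_add
    (walkWeight_le_length_mul (sub_nonneg.2 hab) fun i hi j hj =>
      Real.dist_le_of_mem_Icc (hx i hi) (hx j hj))
    (walkWeight_abs_sub_le_of_pairwise hl hce hy)

/-- The points are cut by vertical lines into strips with at most `k` points each. The strips are
visited from left to right, every one of them from the bottom to the top, and `M` pays for the step
from one strip to the next one. -/
theorem exists_perm_walkWeight_planeDist_le_of_pairwise {x y : ι → ℝ} {k q : ℕ} {l : List ι}
    (hl : l.Pairwise fun i j => x i ≤ x j) (hlen : l.length ≤ k * q) {a b c e M : ℝ}
    (hab : a ≤ b) (hce : c ≤ e) (hM : (b - a) + (e - c) ≤ M) (hx : ∀ i ∈ l, x i ∈ Set.Icc a b)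
    (hy : ∀ i ∈ l, y i ∈ Set.Icc c e) :
    ∃ l', l'.Perm l ∧ walkWeight (planeDist x y) l' ≤ k * (b - a) + q * ((e - c) + M) := by
  induction q generalizing l a with
  | zero =>
    obtain rfl : l = [] := List.length_eq_zero_iff.1 (by simpa using hlen)
    exact ⟨[], List.Perm.refl _, by simpa using mul_nonneg k.cast_nonneg (sub_nonneg.2 hab)⟩
  | succ q ih =>
    obtain ⟨t, ⟨hat, htb⟩, htake, hdrop⟩ := exists_mem_Icc_forall_take_drop hl hab hx k
    obtain ⟨r, hr, hr_le⟩ := ih (hl.sublist (List.drop_sublist k l))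
      (by rw [List.length_drop, Nat.sub_le_iff_le_add]; exact hlen) htb (by linarith) hdrop
      fun i hi => hy i (List.mem_of_mem_drop hi)
    obtain ⟨s, hs, hs_sorted⟩ := exists_perm_pairwise_le y (l.take k)
    have hsl : ∀ i ∈ s, i ∈ l := fun i hi => List.mem_of_mem_take (hs.mem_iff.1 hi)
    have hrl : ∀ i ∈ r, i ∈ l := fun i hi => List.mem_of_mem_drop (hr.mem_iff.1 hi)
    refine ⟨s ++ r, by simpa only [List.take_append_drop] using hs.append hr, ?_⟩
    have hstrip : walkWeight (planeDist x y) s ≤ k * (t - a) + (e - c) := by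
      refine (walkWeight_planeDist_le_of_pairwise hs_sorted hat hce
        (fun i hi => htake i (hs.mem_iff.1 hi)) fun i hi => hy i (hsl i hi)).trans ?_
      have hs_len : s.length ≤ k := hs.length_eq.trans_le (List.length_take_le k l)
      gcongr
    have hjoin := walkWeight_append_le (d := planeDist x y) (l₁ := s) (l₂ := r) (D := M)
      (by linarith) fun i hi j hj =>
        (planeDist_le (hx i (hsl i hi)) (hx j (hrl j hj)) (hy i (hsl i hi))
          (hy j (hrl j hj))).trans hM
    push_cast
    linarith

theorem exists_perm_walkWeight_planeDist_le {x y : ι → ℝ} {k : ℕ} {l : List ι}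
    (hlen : l.length ≤ k * k) {a b : ℝ} (hab : a ≤ b) (hx : ∀ i ∈ l, x i ∈ Set.Icc a b)
    (hy : ∀ i ∈ l, y i ∈ Set.Icc a b) :
    ∃ l', l'.Perm l ∧ walkWeight (planeDist x y) l' ≤ 4 * k * (b - a) := by
  obtain ⟨s, hs, hs_sorted⟩ := exists_perm_pairwise_le x l
  obtain ⟨r, hr, hr_le⟩ := exists_perm_walkWeight_planeDist_le_of_pairwise hs_sorted
    (hs.length_eq.trans_le hlen) hab hab le_rfl (fun i hi => hx i (hs.mem_iff.1 hi))
    fun i hi => hy i (hs.mem_iff.1 hi)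
  exact ⟨r, hr.trans hs, hr_le.trans_eq (by ring)⟩

end Strips

/-! ### Families of intervals of bounded depth -/

section Intervals

variable {ι κ : Type*} [LinearOrder κ]

theorem exists_median (g : ι → κ) {l : List ι} (hl : l ≠ []) :
    ∃ j ∈ l, 2 * l.countP (fun i => g i < g j) ≤ l.length ∧
      2 * l.countP (fun i => g j < g i) ≤ l.length := by
  obtain ⟨s, hs, hsorted⟩ := exists_perm_pairwise_le g l
  have hpos := List.length_pos_iff.2 hl
  have hlen : s.length / 2 < s.length := by have := hs.length_eq; omega
  obtain ⟨s₁, j, s₂, rfl, hs₁⟩ : ∃ s₁ j s₂, s = s₁ ++ j :: s₂ ∧ s₁.length = s.length / 2 :=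
    ⟨_, _, _, by rw [List.getElem_cons_drop hlen, List.take_append_drop],
      List.length_take_of_le hlen.le⟩
  obtain ⟨-, hj_tail, hcross⟩ := List.pairwise_append.1 hsorted
  have hbelow : (j :: s₂).countP (fun i => g i < g j) = 0 := List.countP_eq_zero.2 fun i hi => by
    rcases List.mem_cons.1 hi with rfl | hi
    · simp
    · simpa using List.rel_of_pairwise_cons hj_tail hi
  have habove : s₁.countP (fun i => g j < g i) = 0 := List.countP_eq_zero.2 fun i hi => by
    simpa using hcross i hi j (by simp)
  have hle₁ := s₁.countP_le_length (p := fun i => decide (g i < g j))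
  have hle₂ := s₂.countP_le_length (p := fun i => decide (g j < g i))
  refine ⟨j, hs.mem_iff.1 (by simp), ?_⟩
  rw [← hs.length_eq, ← hs.countP_eq, ← hs.countP_eq, List.countP_append, List.countP_append,
    hbelow, habove, List.countP_cons, if_neg (by simp)]
  simp only [List.length_append, List.length_cons] at hs₁ ⊢
  omega

theorem filter_split_perm {α β : ι → κ} {l : List ι} (h : ∀ j ∈ l, α j < β j) (p : κ) :
    (l.filter (fun j => β j ≤ p) ++ l.filter (fun j => α j ≤ p ∧ p < β j) ++
      l.filter (fun j => p < α j)).Perm l := by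
  induction l with
  | nil => simp
  | cons i l ih =>
    have ih := ih fun j hj => h j (List.mem_cons_of_mem _ hj)
    have hi := h i (by simp)
    rcases le_or_gt (β i) p with hβ | hβ
    · simpa [List.filter_cons, hβ, hi.le.trans hβ, hβ.not_gt, (hi.le.trans hβ).not_gt] using ih
    rcases le_or_gt (α i) p with hα | hα
    · simpa [List.filter_cons, hβ, hα, hβ.not_ge, hα.not_gt] using
        List.perm_middle.trans (List.Perm.cons i (by simpa using ih))
    · simpa [List.filter_cons, hβ, hα, hβ.not_ge, hα.not_ge] using
        List.perm_middle.trans (List.Perm.cons i ih)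

theorem exists_halving_mem {α β : ι → κ} {l : List ι} (hl : l ≠ []) (h : ∀ j ∈ l, α j < β j) :
    ∃ j ∈ l, 2 * (l.filter fun i => β i ≤ α j).length ≤ l.length ∧
      2 * (l.filter fun i => α j < α i).length ≤ l.length := by
  obtain ⟨j, hj, hbelow, habove⟩ := exists_median α hl
  refine ⟨j, hj, ?_, by rwa [← List.countP_eq_length_filter]⟩
  rw [← List.countP_eq_length_filter]
  refine (Nat.mul_le_mul_left 2 (List.countP_mono_left fun i hi hβ => ?_)).trans hbelow
  simpa using (h i hi).trans_le (by simpa using hβ)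

/-- Halve the family at a median `p` of the left end points. The intervals to the left of `p` and
those to the right of `p` are ordered recursively. The remaining ones all cover `p`, so there are
few of them, and they are points of a square if an interval is regarded as the pair of its end
points. -/
theorem exists_perm_walkWeight_endpoints_le {f : κ → ℝ} (hf : Monotone f) {α β : ι → κ}
    {k n : ℕ} {l : List ι} (hlen : l.length < 2 ^ n) (hαβ : ∀ j ∈ l, α j < β j)
    (hdepth : ∀ p, l.countP (fun j => α j ≤ p ∧ p < β j) ≤ k * k) {u v : κ} (huv : u ≤ v)
    (hu : ∀ j ∈ l, u ≤ α j) (hv : ∀ j ∈ l, β j ≤ v) :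
    ∃ l', l'.Perm l ∧
      walkWeight (planeDist (f ∘ α) (f ∘ β)) l' ≤ (4 * k + 4) * n * (f v - f u) := by
  induction n generalizing l u v with
  | zero => exact ⟨[], by simp_all, by simp⟩
  | succ n ih =>
    have hfuv : 0 ≤ f v - f u := sub_nonneg.2 (hf huv)
    rcases eq_or_ne l [] with rfl | hne
    · exact ⟨[], List.Perm.refl _, by simp only [walkWeight_nil]; positivity⟩
    obtain ⟨j₀, hj₀, hA_len, hB_len⟩ := exists_halving_mem hne hαβ
    set p := α j₀
    have hpv : p ≤ v := (hαβ j₀ hj₀).le.trans (hv j₀ hj₀)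
    set A := l.filter fun j => β j ≤ p
    set X := l.filter fun j => α j ≤ p ∧ p < β j
    set B := l.filter fun j => p < α j
    have hA : ∀ j ∈ A, j ∈ l ∧ β j ≤ p := fun j hj => by simpa [A] using hj
    have hX : ∀ j ∈ X, j ∈ l := fun j hj => List.mem_of_mem_filter hj
    have hB : ∀ j ∈ B, j ∈ l ∧ p < α j := fun j hj => by simpa [B] using hj
    have hsub : ∀ {l' : List ι}, l'.Sublist l →
        ∀ q, l'.countP (fun j => α j ≤ q ∧ q < β j) ≤ k * k :=
      fun h q => h.countP_le.trans (hdepth q)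
    obtain ⟨LA, hLA, hLA_le⟩ := ih (l := A) (by omega) (fun j hj => hαβ j (hA j hj).1)
      (hsub List.filter_sublist) (hu j₀ hj₀) (fun j hj => hu j (hA j hj).1) fun j hj => (hA j hj).2
    obtain ⟨LB, hLB, hLB_le⟩ := ih (l := B) (by omega) (fun j hj => hαβ j (hB j hj).1)
      (hsub List.filter_sublist) hpv (fun j hj => (hB j hj).2.le) fun j hj => hv j (hB j hj).1
    have hfα : ∀ j ∈ l, (f ∘ α) j ∈ Set.Icc (f u) (f v) := fun j hj =>
      ⟨hf (hu j hj), hf ((hαβ j hj).le.trans (hv j hj))⟩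
    have hfβ : ∀ j ∈ l, (f ∘ β) j ∈ Set.Icc (f u) (f v) := fun j hj =>
      ⟨hf ((hu j hj).trans (hαβ j hj).le), hf (hv j hj)⟩
    obtain ⟨LX, hLX, hLX_le⟩ := exists_perm_walkWeight_planeDist_le
      (List.countP_eq_length_filter.symm.trans_le (hdepth p)) (hf huv)
      (fun j hj => hfα j (hX j hj)) fun j hj => hfβ j (hX j hj)
    have hperm : (LA ++ LX ++ LB).Perm l :=
      ((hLA.append hLX).append hLB).trans (filter_split_perm hαβ p)
    have hjump : ∀ i ∈ LA ++ LX ++ LB, ∀ j ∈ LA ++ LX ++ LB,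
        planeDist (f ∘ α) (f ∘ β) i j ≤ (f v - f u) + (f v - f u) := fun i hi j hj =>
      planeDist_le (hfα i (hperm.mem_iff.1 hi)) (hfα j (hperm.mem_iff.1 hj))
        (hfβ i (hperm.mem_iff.1 hi)) (hfβ j (hperm.mem_iff.1 hj))
    have hjoin := walkWeight_append_append_le (add_nonneg hfuv hfuv) hjump
    refine ⟨_, hperm, ?_⟩
    push_cast
    linarith

theorem sum_map_sub_eq_sum_countP_mul (f : ℕ → ℝ) {α β : ι → ℕ} {N : ℕ} {l : List ι}
    (hαβ : ∀ j ∈ l, α j ≤ β j) (hβ : ∀ j ∈ l, β j ≤ N) :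
    (l.map fun j => f (β j) - f (α j)).sum =
      ∑ p ∈ Finset.range N, l.countP (fun j => α j ≤ p ∧ p < β j) * (f (p + 1) - f p) := by
  induction l with
  | nil => simp
  | cons i l ih =>
    have hhead : f (β i) - f (α i) =
        ∑ p ∈ Finset.range N, if α i ≤ p ∧ p < β i then f (p + 1) - f p else 0 := by
      have hIco : {p ∈ Finset.range N | α i ≤ p ∧ p < β i} = Finset.Ico (α i) (β i) := by
        ext p
        simp only [Finset.mem_filter, Finset.mem_range, Finset.mem_Ico, and_iff_right_iff_imp]
        exact fun h => h.2.trans_le (hβ i (by simp))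
      rw [← Finset.sum_filter, hIco, Finset.sum_Ico_sub _ (hαβ i (by simp))]
    rw [List.map_cons, List.sum_cons, ih (fun j hj => hαβ j (List.mem_cons_of_mem _ hj))
      (fun j hj => hβ j (List.mem_cons_of_mem _ hj)), hhead, ← Finset.sum_add_distrib]
    refine Finset.sum_congr rfl fun p _ => ?_
    rw [List.countP_cons]
    by_cases h : α i ≤ p ∧ p < β i <;> simp [h, add_mul, add_comm]

theorem sum_map_sub_le_of_countP_le {f : ℕ → ℝ} (hf : Monotone f) {α β : ι → ℕ} {N c : ℕ}
    {l : List ι} (hαβ : ∀ j ∈ l, α j ≤ β j) (hβ : ∀ j ∈ l, β j ≤ N)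
    (hdepth : ∀ p, l.countP (fun j => α j ≤ p ∧ p < β j) ≤ c) :
    (l.map fun j => f (β j) - f (α j)).sum ≤ c * (f N - f 0) := by
  rw [sum_map_sub_eq_sum_countP_mul f hαβ hβ, ← Finset.sum_range_sub, Finset.mul_sum]
  exact Finset.sum_le_sum fun p _ => mul_le_mul_of_nonneg_right (mod_cast hdepth p)
    (sub_nonneg.2 (hf p.le_succ))

end Intervals

/-! ### Lower bounds on the weight of a feasible solution -/

namespace Instance

variable (I : Instance)

theorem w_nonneg (a b : Fin I.n) : 0 ≤ I.w a b := by
  linarith [I.w_triangle a b a, I.w_self a, I.w_symm a b]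

/-- The weight of a single route, driven by vehicle `i`. -/
noncomputable def routeWeight (i : Fin I.h) (l : List (Stop I.n I.m)) : ℝ :=
  walkWeight I.w (I.depot i :: l.map I.loc)

theorem routeWeight_nonneg (i : Fin I.h) (l : List (Stop I.n I.m)) : 0 ≤ I.routeWeight i l :=
  walkWeight_nonneg I.w_nonneg _

theorem routeWeight_le_of_isPrefix (i : Fin I.h) {l₁ l₂ : List (Stop I.n I.m)} (h : l₁ <+: l₂) :
    I.routeWeight i l₁ ≤ I.routeWeight i l₂ :=
  walkWeight_le_of_isPrefix I.w_nonneg (List.prefix_cons_inj _ |>.2 (h.map _))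

theorem weight_eq_sum_routeWeight (R : I.Routes) : I.weight R = ∑ i, I.routeWeight i (R i) := rfl

theorem weight_nonneg (R : I.Routes) : 0 ≤ I.weight R :=
  Finset.sum_nonneg fun i _ => I.routeWeight_nonneg i (R i)

/-- The distance that vehicle `i` has travelled on its route `l` when it arrives at the stop with
index `p`. -/
noncomputable def position (i : Fin I.h) (l : List (Stop I.n I.m)) (p : ℕ) : ℝ :=
  I.routeWeight i (l.take (p + 1))

theorem position_mono (i : Fin I.h) (l : List (Stop I.n I.m)) : Monotone (I.position i l) :=
  fun _ _ hpq => I.routeWeight_le_of_isPrefix i (List.take_prefix_take_left (Nat.succ_le_succ hpq))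

theorem position_nonneg (i : Fin I.h) (l : List (Stop I.n I.m)) (p : ℕ) : 0 ≤ I.position i l p :=
  I.routeWeight_nonneg _ _

theorem position_le (i : Fin I.h) (l : List (Stop I.n I.m)) (p : ℕ) :
    I.position i l p ≤ I.routeWeight i l :=
  I.routeWeight_le_of_isPrefix i (List.take_prefix _ _)

theorem position_sub_le (i : Fin I.h) (l : List (Stop I.n I.m)) (p q : ℕ) :
    I.position i l p - I.position i l q ≤ I.routeWeight i l :=
  (sub_le_self _ (I.position_nonneg i l q)).trans (I.position_le i l p)

variable {I} in
theorem w_loc_le (i : Fin I.h) {l : List (Stop I.n I.m)} {a b : Stop I.n I.m} (hb : b ∈ l)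
    (hab : l.idxOf a ≤ l.idxOf b) :
    I.w (I.loc a) (I.loc b) ≤ I.position i l (l.idxOf b) - I.position i l (l.idxOf a) := by
  have hlt := List.idxOf_lt_length_of_mem hb
  have h := dist_getElem_le I.w_self I.w_triangle (I.depot i :: l.map I.loc)
    (Nat.succ_le_succ hab) (by simpa using hlt)
  simpa [position, routeWeight, List.map_take] using h

variable {I} in
theorem w_depot_loc_le (i : Fin I.h) {l : List (Stop I.n I.m)} {a : Stop I.n I.m} (ha : a ∈ l) :
    I.w (I.depot i) (I.loc a) ≤ I.routeWeight i l := by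
  have hlt := List.idxOf_lt_length_of_mem ha
  have h := dist_getElem_le I.w_self I.w_triangle (I.depot i :: l.map I.loc)
    (Nat.zero_le (l.idxOf a + 1)) (by simpa using hlt)
  refine le_trans ?_ (I.position_le i l (l.idxOf a))
  simpa [position, routeWeight, List.map_take] using h

variable {I} in
theorem w_loc_le_abs_sub (i : Fin I.h) {l : List (Stop I.n I.m)} {a b : Stop I.n I.m}
    (ha : a ∈ l) (hb : b ∈ l) :
    I.w (I.loc a) (I.loc b) ≤ |I.position i l (l.idxOf a) - I.position i l (l.idxOf b)| := by
  rcases le_total (l.idxOf a) (l.idxOf b) with h | h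
  · rw [abs_sub_comm]
    exact (w_loc_le i hb h).trans (le_abs_self _)
  · rw [I.w_symm]
    exact (w_loc_le i ha h).trans (le_abs_self _)

/-- The distance between the source and the destination of a request. -/
def haul (j : Fin I.m) : ℝ := I.w (I.src j) (I.dst j)

theorem haul_nonneg (j : Fin I.m) : 0 ≤ I.haul j := I.w_nonneg _ _

variable {I}

theorem countP_isPickup (l : List (Stop I.n I.m)) :
    l.countP Stop.isPickup = ∑ j, l.count (.pickup j) := by
  induction l with
  | nil => simp
  | cons a l ih =>
    simp only [List.countP_cons, List.count_cons, Finset.sum_add_distrib, ih]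
    cases a <;> simp [Stop.isPickup]

theorem countP_isDelivery (l : List (Stop I.n I.m)) :
    l.countP Stop.isDelivery = ∑ j, l.count (.deliver j) := by
  induction l with
  | nil => simp
  | cons a l ih =>
    simp only [List.countP_cons, List.count_cons, Finset.sum_add_distrib, ih]
    cases a <;> simp [Stop.isDelivery]

/-- The requests that are picked up on a route, in the order in which this happens. -/
def pickups (l : List (Stop I.n I.m)) : List (Fin I.m) :=
  l.filterMap fun
    | .pickup j => some j
    | _ => none

theorem count_pickups (l : List (Stop I.n I.m)) (j : Fin I.m) :
    (pickups l).count j = l.count (.pickup j) := by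
  rw [pickups, List.count_filterMap, List.count]
  refine List.countP_congr fun a _ => ?_
  cases a <;> simp

theorem mem_pickups {l : List (Stop I.n I.m)} {j : Fin I.m} :
    j ∈ pickups l ↔ Stop.pickup j ∈ l := by
  rw [← List.count_pos_iff, count_pickups, List.count_pos_iff]

theorem sum_map_eq_sum_count_nsmul {α M : Type*} [Fintype α] [DecidableEq α] [AddCommMonoid M]
    (l : List α) (F : α → M) : (l.map F).sum = ∑ a, l.count a • F a := by
  rw [Finset.sum_list_map_count]
  refine Finset.sum_subset (Finset.subset_univ _) fun a _ ha => ?_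
  rw [List.count_eq_zero.2 (mt List.mem_toFinset.2 ha), zero_nsmul]

theorem countP_eq_sum_ite_count {α : Type*} [Fintype α] [DecidableEq α] (l : List α)
    (q : α → Bool) : l.countP q = ∑ a, if q a then l.count a else 0 := by
  have h := Finset.sum_filter_count_eq_countP (fun a => q a) l
  simp only [Bool.decide_eq_true] at h
  rw [← Finset.sum_filter, ← h]
  refine Finset.sum_subset (Finset.filter_subset_filter _ (Finset.subset_univ _)) fun a ha ha' => ?_
  exact List.count_eq_zero.2 fun hmem => ha' (by simpa [hmem] using ha)

theorem IsMTSP.sum_sum_map {M : Type*} [AddCommMonoid M] {T : I.Tours} (hT : I.IsMTSP T)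
    (F : Fin I.m → M) : ∑ i, ((T i).map F).sum = ∑ j, F j := by
  simp only [sum_map_eq_sum_count_nsmul]
  rw [Finset.sum_comm]
  exact Finset.sum_congr rfl fun j _ => by rw [← Finset.sum_smul, hT j, one_nsmul]

namespace IsFeasible

variable {R : I.Routes} (hR : I.IsFeasible R) (i : Fin I.h)

include hR

theorem isMTSP_pickups : I.IsMTSP fun i => pickups (R i) := fun j => by
  simp only [count_pickups, hR.pickup_once]

theorem deliver_mem {j : Fin I.m} (hj : j ∈ pickups (R i)) : .deliver j ∈ R i := by
  rwa [mem_pickups, ← List.count_pos_iff, ← hR.same_vehicle, List.count_pos_iff] at hj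

theorem count_pickups_le_one (j : Fin I.m) : (pickups (R i)).count j ≤ 1 :=
  (Finset.single_le_sum (f := fun i => (pickups (R i)).count j) (fun _ _ => Nat.zero_le _)
    (Finset.mem_univ i)).trans_eq (hR.isMTSP_pickups j)

theorem length_pickups_le : (pickups (R i)).length ≤ I.m := by
  have h : ((pickups (R i)).map fun _ => 1).sum ≤ ∑ j : Fin I.m, 1 := by
    rw [← hR.isMTSP_pickups.sum_sum_map]
    exact Finset.single_le_sum (f := fun i => ((pickups (R i)).map fun _ => 1).sum)
      (fun _ _ => Nat.zero_le _) (Finset.mem_univ i)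
  simpa using h

theorem idxOf_pickup_lt {j : Fin I.m} (hj : j ∈ pickups (R i)) :
    (R i).idxOf (.pickup j) < (R i).idxOf (.deliver j) := by
  have hd := hR.deliver_mem i hj
  have hp := mem_pickups.1 hj
  have hle : (R i).idxOf (.pickup j) ≤ (R i).idxOf (.deliver j) := by
    have hd_pos := List.count_pos_iff.2
      ((List.mem_take_iff_idxOf_lt hd).2 (Nat.lt_succ_self ((R i).idxOf (.deliver j))))
    have hp_mem := List.count_pos_iff.1
      (hd_pos.trans_le (hR.order i j _ (List.take_prefix _ _)))
    exact Nat.le_of_lt_succ ((List.mem_take_iff_idxOf_lt hp).1 hp_mem)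
  refine hle.lt_of_ne fun h => ?_
  rw [List.idxOf_inj hp] at h
  cases h

theorem countP_onboard_le (p : ℕ) :
    (pickups (R i)).countP
      (fun j => (R i).idxOf (.pickup j) ≤ p ∧ p < (R i).idxOf (.deliver j)) ≤ I.cap := by
  set l := (R i).take (p + 1)
  have hl : l <+: R i := List.take_prefix _ _
  have hcap := hR.capacity i l hl
  rw [countP_isPickup, countP_isDelivery] at hcap
  rw [countP_eq_sum_ite_count]
  refine Nat.le_of_add_le_add_left (hcap.trans' ?_)
  rw [← Finset.sum_add_distrib]
  refine Finset.sum_le_sum fun j _ => ?_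
  split_ifs with hj
  · rw [decide_eq_true_eq] at hj
    by_cases hmem : j ∈ pickups (R i)
    · have hpick : 0 < l.count (.pickup j) := List.count_pos_iff.2
        ((List.mem_take_iff_idxOf_lt (mem_pickups.1 hmem)).2 (Nat.lt_succ_of_le hj.1))
      have hdel : l.count (.deliver j) = 0 := List.count_eq_zero.2 fun h =>
        hj.2.not_ge (Nat.le_of_lt_succ
          ((List.mem_take_iff_idxOf_lt (hR.deliver_mem i hmem)).1 h))
      have hone := hR.count_pickups_le_one i j
      omega
    · rw [List.count_eq_zero.2 hmem, add_zero]
      exact hR.order i j l hl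
  · exact hR.order i j l hl

theorem sum_haul_pickups_le :
    ((pickups (R i)).map I.haul).sum ≤ I.cap * I.routeWeight i (R i) := by
  have hβ : ∀ j ∈ pickups (R i), (R i).idxOf (.deliver j) ≤ (R i).length := fun j _ =>
    List.idxOf_le_length
  calc ((pickups (R i)).map I.haul).sum
      ≤ ((pickups (R i)).map fun j => I.position i (R i) ((R i).idxOf (.deliver j)) -
          I.position i (R i) ((R i).idxOf (.pickup j))).sum :=
        List.sum_le_sum fun j hj => w_loc_le i (hR.deliver_mem i hj) (hR.idxOf_pickup_lt i hj).le
    _ ≤ I.cap * (I.position i (R i) (R i).length - I.position i (R i) 0) :=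
        sum_map_sub_le_of_countP_le (I.position_mono i _)
          (fun j hj => (hR.idxOf_pickup_lt i hj).le) hβ (hR.countP_onboard_le i)
    _ ≤ I.cap * I.routeWeight i (R i) := by
        gcongr
        exact I.position_sub_le i (R i) _ _

/-- Every unit of length of the route lies between the pickup and the delivery of at most `cap`
requests. -/
theorem sum_haul_le : ∑ j, I.haul j ≤ I.cap * I.weight R := by
  rw [← hR.isMTSP_pickups.sum_sum_map, weight_eq_sum_routeWeight, Finset.mul_sum]
  exact Finset.sum_le_sum fun i _ => hR.sum_haul_pickups_le i

/-- The positions of the vehicle at the pickup and at the delivery of a request are the end points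
of an interval, and no point is covered by more than `cap` of these intervals. -/
theorem exists_tour {k n : ℕ} (hk : I.cap ≤ k * k) (hn : I.m < 2 ^ n) :
    ∃ L : List (Fin I.m), L.Perm (pickups (R i)) ∧
      tourWeight I.wH (Sum.inl i :: L.map Sum.inr) ≤
        ((4 * k + 4) * n + 4) * I.routeWeight i (R i) := by
  obtain ⟨L, hL, hL_le⟩ := exists_perm_walkWeight_endpoints_le (I.position_mono i (R i))
    ((hR.length_pickups_le i).trans_lt hn) (fun j hj => hR.idxOf_pickup_lt i hj)
    (fun p => (hR.countP_onboard_le i p).trans hk) (Nat.zero_le (R i).length)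
    (fun _ _ => Nat.zero_le _) fun j _ => List.idxOf_le_length
  have hW := I.routeWeight_nonneg i (R i)
  have hpick : ∀ j ∈ L, Stop.pickup j ∈ R i := fun j hj => mem_pickups.1 (hL.mem_iff.1 hj)
  have hdel : ∀ j ∈ L, Stop.deliver j ∈ R i := fun j hj => hR.deliver_mem i (hL.mem_iff.1 hj)
  have hpath : walkWeight I.wH (L.map Sum.inr) ≤ (4 * k + 4) * n * I.routeWeight i (R i) := by
    rw [walkWeight_map]
    refine (walkWeight_mono fun a ha b hb => ?_).trans (hL_le.trans ?_)
    · exact add_le_add (w_loc_le_abs_sub i (hpick a ha) (hpick b hb))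
        (w_loc_le_abs_sub i (hdel a ha) (hdel b hb))
    · gcongr
      exact I.position_sub_le i (R i) _ _
  have hspoke : ∀ a ∈ Sum.inl i :: L.map Sum.inr, I.wH (Sum.inl i) a ≤ 2 * I.routeWeight i (R i) ∧
      I.wH a (Sum.inl i) ≤ 2 * I.routeWeight i (R i) := by
    have hself : I.wH (Sum.inl i) (Sum.inl i) ≤ 2 * I.routeWeight i (R i) := by
      rw [wH, I.w_self]
      linarith
    have hreq : ∀ j ∈ L, I.wH (Sum.inl i) (Sum.inr j) ≤ 2 * I.routeWeight i (R i) := fun j hj =>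
      (add_le_add (w_depot_loc_le i (hpick j hj)) (w_depot_loc_le i (hdel j hj))).trans_eq
        (two_mul _).symm
    simpa using ⟨hself, fun j hj => ⟨hreq j hj, hreq j hj⟩⟩
  refine ⟨L, hL, (tourWeight_cons_le (by positivity) hspoke).trans ?_⟩
  linarith

theorem exists_isMTSP {k n : ℕ} (hk : I.cap ≤ k * k) (hn : I.m < 2 ^ n) :
    ∃ S : I.Tours, I.IsMTSP S ∧ I.mtspWeight S ≤ ((4 * k + 4) * n + 4) * I.weight R := by
  choose S hS hS_le using fun i => hR.exists_tour i hk hn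
  refine ⟨S, fun j => ?_, ?_⟩
  · simp only [fun i => (hS i).count_eq j, hR.isMTSP_pickups j]
  · rw [weight_eq_sum_routeWeight, Finset.mul_sum]
    exact Finset.sum_le_sum fun i _ => hS_le i

end IsFeasible

end Instance

/-! ### Cutting a list into fragments -/

section Fragments

variable {α : Type*}

/-- The list `L`, cut into pieces of length `c`, the last one possibly shorter. -/
def chunks (c : ℕ) (L : List α) : List (List α) :=
  (List.range (L.length ⌈/⌉ c)).map fun k => (L.drop (c * k)).take c

theorem fragments_eq_cons_chunks (c θ : ℕ) (L : List α) :
    Instance.fragments c θ L = L.take θ :: chunks c (L.drop θ) := by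
  simp [Instance.fragments, chunks, List.length_drop, List.drop_drop]

@[simp] theorem chunks_nil (c : ℕ) : chunks c ([] : List α) = [] := by
  simp [chunks]

theorem chunks_eq_cons {c : ℕ} (hc : 0 < c) {L : List α} (hL : L ≠ []) :
    chunks c L = L.take c :: chunks c (L.drop c) := by
  have hpos : 0 < L.length := List.length_pos_iff.2 hL
  have hlen : L.length ⌈/⌉ c = (L.drop c).length ⌈/⌉ c + 1 := by
    rw [List.length_drop, Nat.ceilDiv_eq_add_pred_div, Nat.ceilDiv_eq_add_pred_div]
    rcases le_total c L.length with h | h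
    · rw [← Nat.add_div_right _ hc]
      congr 1
      omega
    · rw [Nat.sub_eq_zero_of_le h, Nat.div_eq_of_lt (by omega : 0 + c - 1 < c)]
      exact Nat.div_eq_of_lt_le (by omega) (by omega)
  simp only [chunks, hlen, List.range_succ_eq_map, List.map_cons, List.map_map, Nat.mul_zero,
    List.drop_zero, List.drop_drop, Function.comp_def, Nat.succ_eq_add_one, Nat.mul_succ,
    Nat.add_comm c]

theorem chunks_induction {c : ℕ} (hc : 0 < c) {p : List α → Prop} (nil : p [])
    (step : ∀ L, L ≠ [] → p (L.drop c) → p L) (L : List α) : p L := by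
  induction hn : L.length using Nat.strong_induction_on generalizing L with
  | _ n ih =>
    rcases eq_or_ne L [] with rfl | hL
    · exact nil
    · have hpos := List.length_pos_iff.2 hL
      exact step L hL (ih _ (by rw [List.length_drop]; omega) _ rfl)

theorem flatten_chunks {c : ℕ} (hc : 0 < c) (L : List α) : (chunks c L).flatten = L := by
  induction L using chunks_induction hc with
  | nil => simp
  | step L hL ih => rw [chunks_eq_cons hc hL, List.flatten_cons, ih, List.take_append_drop]

theorem length_le_of_mem_chunks {c : ℕ} {L F : List α} (hF : F ∈ chunks c L) : F.length ≤ c := by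
  obtain ⟨k, -, rfl⟩ := List.mem_map.1 hF
  exact List.length_take_le _ _

theorem ne_nil_of_mem_chunks {c : ℕ} (hc : 0 < c) {L F : List α} (hF : F ∈ chunks c L) :
    F ≠ [] := by
  induction L using chunks_induction hc with
  | nil => simp at hF
  | step L hL ih =>
    rw [chunks_eq_cons hc hL] at hF
    rcases List.mem_cons.1 hF with rfl | hF
    · simpa [List.take_eq_nil_iff, hL] using hc.ne'
    · exact ih hF

/-- The value of `D` at the last element of a list, zero for the empty list. -/
def endValue (D : α → ℝ) (F : List α) : ℝ := F.getLast?.elim 0 D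

@[simp] theorem endValue_nil (D : α → ℝ) : endValue D [] = 0 := rfl

theorem endValue_eq (D : α → ℝ) {F : List α} (hF : F ≠ []) :
    endValue D F = D (F.getLast hF) := by
  rw [endValue, List.getLast?_eq_some_getLast hF, Option.elim_some]

theorem endValue_drop (D : α → ℝ) {L : List α} {k : ℕ} (hk : k < L.length) :
    endValue D (L.drop k) = endValue D L := by
  rw [endValue, endValue, List.getLast?_drop, if_neg hk.not_ge]

/-- The sum of the values of `D` at the positions of a list that are congruent to `φ` modulo `c`,
where positions are counted from `1`. -/
def residueSum (D : α → ℝ) {c : ℕ} : ZMod c → List α → ℝ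
  | _, [] => 0
  | φ, x :: l => (if φ = 1 then D x else 0) + residueSum D (φ - 1) l

theorem residueSum_nonneg {D : α → ℝ} (hD : ∀ x, 0 ≤ D x) {c : ℕ} (φ : ZMod c) (L : List α) :
    0 ≤ residueSum D φ L := by
  induction L generalizing φ with
  | nil => exact le_rfl
  | cons x l ih =>
    refine add_nonneg ?_ (ih _)
    split_ifs
    · exact hD x
    · exact le_rfl

theorem residueSum_append (D : α → ℝ) {c : ℕ} (φ : ZMod c) (l₁ l₂ : List α) :
    residueSum D φ (l₁ ++ l₂) = residueSum D φ l₁ + residueSum D (φ - (l₁.length : ZMod c)) l₂ := by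
  induction l₁ generalizing φ with
  | nil => simp [residueSum]
  | cons x l ih =>
    simp only [List.cons_append, residueSum, ih, List.length_cons, Nat.cast_add, Nat.cast_one]
    rw [sub_sub φ, add_comm (1 : ZMod c), add_assoc]

theorem endValue_le_residueSum {D : α → ℝ} (hD : ∀ x, 0 ≤ D x) (c : ℕ) (F : List α) :
    endValue D F ≤ residueSum D (F.length : ZMod c) F := by
  rcases List.eq_nil_or_concat F with rfl | ⟨l, x, rfl⟩
  · exact le_rfl
  · rw [List.concat_eq_append, endValue_eq D (by simp), residueSum_append]
    simpa [residueSum] using residueSum_nonneg hD ((l ++ [x]).length : ZMod c) l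

theorem sum_residueSum (D : α → ℝ) {c : ℕ} [NeZero c] (L : List α) :
    ∑ φ : ZMod c, residueSum D φ L = (L.map D).sum := by
  induction L with
  | nil => simp [residueSum]
  | cons x l ih =>
    simp only [residueSum, Finset.sum_add_distrib, Finset.sum_ite_eq', Finset.mem_univ, if_true,
      List.map_cons, List.sum_cons]
    rw [← ih, ← Equiv.sum_comp (Equiv.subRight (1 : ZMod c)) fun φ => residueSum D φ l]
    rfl

theorem sum_residueSum_natCast_succ (D : α → ℝ) {c : ℕ} [NeZero c] (L : List α) :
    ∑ k : Fin c, residueSum D (((k : ℕ) + 1 : ℕ) : ZMod c) L = (L.map D).sum := by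
  obtain ⟨n, rfl⟩ := Nat.exists_eq_succ_of_ne_zero (NeZero.ne c)
  rw [← sum_residueSum (c := n + 1),
    ← Equiv.sum_comp (Equiv.addRight (1 : ZMod (n + 1))) fun φ => residueSum D φ L]
  refine Finset.sum_congr rfl fun k _ => ?_
  rw [Nat.cast_add, Nat.cast_one]
  congr 2
  exact Fin.cast_val_eq_self k

theorem sum_endValue_chunks_le {D : α → ℝ} (hD : ∀ x, 0 ≤ D x) {c : ℕ} (hc : 0 < c)
    (L : List α) :
    ((chunks c L).map (endValue D)).sum ≤ residueSum D (0 : ZMod c) L + endValue D L := by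
  induction L using chunks_induction hc with
  | nil => simp [residueSum]
  | step L hL ih =>
    rw [chunks_eq_cons hc hL, List.map_cons, List.sum_cons]
    rcases le_or_gt L.length c with h | h
    · rw [List.drop_eq_nil_of_le h, List.take_of_length_le h]
      simpa using residueSum_nonneg hD (0 : ZMod c) L
    · have hlen : ((L.take c).length : ZMod c) = 0 := by
        rw [List.length_take, min_eq_left h.le, ZMod.natCast_self]
      have hhead := endValue_le_residueSum hD c (L.take c)
      have hsplit := residueSum_append D (0 : ZMod c) (L.take c) (L.drop c)
      rw [hlen] at hhead
      rw [List.take_append_drop, hlen, sub_zero] at hsplit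
      rw [endValue_drop D h] at ih
      linarith

theorem sum_endValue_fragments_le {D : α → ℝ} (hD : ∀ x, 0 ≤ D x) {c θ : ℕ} (hc : 0 < c)
    {L : List α} (hθ : θ < L.length) :
    ((Instance.fragments c θ L).map (endValue D)).sum ≤
      residueSum D (θ : ZMod c) L + endValue D L := by
  have hlen : (L.take θ).length = θ := by rw [List.length_take, min_eq_left hθ.le]
  have hhead := endValue_le_residueSum hD c (L.take θ)
  have htail := sum_endValue_chunks_le hD hc (L.drop θ)
  have hsplit := residueSum_append D (θ : ZMod c) (L.take θ) (L.drop θ)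
  rw [hlen] at hhead
  rw [endValue_drop D hθ] at htail
  rw [List.take_append_drop, hlen, sub_self] at hsplit
  rw [fragments_eq_cons_chunks, List.map_cons, List.sum_cons]
  linarith

end Fragments

namespace Instance

variable (I : Instance)

/-- The fragments in which vehicle `i` serves the requests of its tour. -/
def algFragments (T : I.Tours) (θ : Fin I.h → ℕ) (i : Fin I.h) : List (List (Fin I.m)) :=
  if (T i).length ≤ I.cap then [T i] else fragments I.cap (θ i) (T i)

theorem algRoutes_eq_flatMap_serve (T : I.Tours) (θ : Fin I.h → ℕ) (i : Fin I.h) :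
    I.algRoutes T θ i = (I.algFragments T θ i).flatMap I.serve := by
  unfold algRoutes algFragments
  split_ifs <;> simp

theorem flatten_algFragments (T : I.Tours) (θ : Fin I.h → ℕ) (i : Fin I.h) :
    (I.algFragments T θ i).flatten = T i := by
  unfold algFragments
  split_ifs
  · simp
  · rw [fragments_eq_cons_chunks, List.flatten_cons, flatten_chunks I.cap_pos,
      List.take_append_drop]

variable {I}

theorem length_le_of_mem_algFragments {T : I.Tours} {θ : Fin I.h → ℕ} {i : Fin I.h}
    (hθ : θ i ≤ I.cap) {F : List (Fin I.m)} (hF : F ∈ I.algFragments T θ i) :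
    F.length ≤ I.cap := by
  unfold algFragments at hF
  split_ifs at hF with h
  · rwa [List.mem_singleton.1 hF]
  · rw [fragments_eq_cons_chunks] at hF
    rcases List.mem_cons.1 hF with rfl | hF
    · exact (List.length_take_le _ _).trans hθ
    · exact length_le_of_mem_chunks hF

theorem ne_nil_of_mem_algFragments {T : I.Tours} {θ : Fin I.h → ℕ} {i : Fin I.h}
    (hθ : 1 ≤ θ i) (hT : T i ≠ []) {F : List (Fin I.m)} (hF : F ∈ I.algFragments T θ i) :
    F ≠ [] := by
  unfold algFragments at hF
  split_ifs at hF with h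
  · rwa [List.mem_singleton.1 hF]
  · rw [fragments_eq_cons_chunks] at hF
    rcases List.mem_cons.1 hF with rfl | hF
    · simpa [List.take_eq_nil_iff, hT] using Nat.one_le_iff_ne_zero.1 hθ
    · exact ne_nil_of_mem_chunks I.cap_pos hF

variable (I)

/-! ### Feasibility of the routes -/

theorem isPrefix_or_of_isPrefix_append {α : Type*} {p l₁ l₂ : List α} (h : p <+: l₁ ++ l₂) :
    p <+: l₁ ∨ ∃ q, q <+: l₂ ∧ p = l₁ ++ q := by
  obtain ⟨r, hr⟩ := h
  rcases List.append_eq_append_iff.1 hr with ⟨q, h₁, -⟩ | ⟨q, h₁, h₂⟩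
  · exact Or.inl ⟨q, h₁.symm⟩
  · exact Or.inr ⟨q, ⟨r, h₂.symm⟩, h₁⟩

theorem count_pickup_serve (B : List (Fin I.m)) (j : Fin I.m) :
    (I.serve B).count (.pickup j) = B.count j := by
  rw [serve, List.count_append, List.count_map_of_injective _ _ fun _ _ => Stop.pickup.inj,
    List.count_eq_zero_of_not_mem (l := B.map Stop.deliver) (by simp), Nat.add_zero]

theorem count_deliver_serve (B : List (Fin I.m)) (j : Fin I.m) :
    (I.serve B).count (.deliver j) = B.count j := by
  rw [serve, List.count_append, List.count_map_of_injective _ _ fun _ _ => Stop.deliver.inj,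
    List.count_eq_zero_of_not_mem (l := B.map Stop.pickup) (by simp), Nat.zero_add]

theorem count_pickup_flatMap_serve (Fs : List (List (Fin I.m))) (j : Fin I.m) :
    (Fs.flatMap I.serve).count (.pickup j) = Fs.flatten.count j := by
  simp [List.count_flatMap, List.count_flatten, Function.comp_def, count_pickup_serve]

theorem count_deliver_flatMap_serve (Fs : List (List (Fin I.m))) (j : Fin I.m) :
    (Fs.flatMap I.serve).count (.deliver j) = Fs.flatten.count j := by
  simp [List.count_flatMap, List.count_flatten, Function.comp_def, count_deliver_serve]

theorem countP_isPickup_serve (B : List (Fin I.m)) :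
    (I.serve B).countP Stop.isPickup = B.length := by
  simp [serve, Function.comp_def, Stop.isPickup]

theorem countP_isDelivery_serve (B : List (Fin I.m)) :
    (I.serve B).countP Stop.isDelivery = B.length := by
  simp [serve, Function.comp_def, Stop.isDelivery]

variable {I}

theorem count_deliver_le_of_isPrefix_serve {B : List (Fin I.m)} {p : List (Stop I.n I.m)}
    (hp : p <+: I.serve B) (j : Fin I.m) : p.count (.deliver j) ≤ p.count (.pickup j) := by
  rcases isPrefix_or_of_isPrefix_append hp with h | ⟨q, -, rfl⟩
  · rw [List.count_eq_zero.2 fun hm => by simpa using h.subset hm]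
    exact Nat.zero_le _
  · calc (B.map Stop.pickup ++ q).count (Stop.deliver j)
        ≤ (I.serve B).count (Stop.deliver j) := hp.sublist.count_le _
      _ = (B.map (Stop.pickup (n := I.n))).count (Stop.pickup j) := by
        rw [count_deliver_serve, List.count_map_of_injective _ _ fun _ _ => Stop.pickup.inj]
      _ ≤ (B.map Stop.pickup ++ q).count (Stop.pickup j) :=
        (List.sublist_append_left _ _).count_le _

theorem count_deliver_le_of_isPrefix {Fs : List (List (Fin I.m))} {p : List (Stop I.n I.m)}
    (hp : p <+: Fs.flatMap I.serve) (j : Fin I.m) :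
    p.count (.deliver j) ≤ p.count (.pickup j) := by
  induction Fs generalizing p with
  | nil => simp [List.prefix_nil.1 hp]
  | cons F Fs ih =>
    rw [List.flatMap_cons] at hp
    rcases isPrefix_or_of_isPrefix_append hp with h | ⟨q, h, rfl⟩
    · exact count_deliver_le_of_isPrefix_serve h j
    · rw [List.count_append, List.count_append, count_pickup_serve, count_deliver_serve]
      exact Nat.add_le_add_left (ih h) _

theorem countP_isPickup_le_of_isPrefix {Fs : List (List (Fin I.m))}
    (hFs : ∀ F ∈ Fs, F.length ≤ I.cap) {p : List (Stop I.n I.m)} (hp : p <+: Fs.flatMap I.serve) :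
    p.countP Stop.isPickup ≤ p.countP Stop.isDelivery + I.cap := by
  induction Fs generalizing p with
  | nil => simp [List.prefix_nil.1 hp]
  | cons F Fs ih =>
    rw [List.flatMap_cons] at hp
    rcases isPrefix_or_of_isPrefix_append hp with h | ⟨q, h, rfl⟩
    · calc p.countP Stop.isPickup ≤ (I.serve F).countP Stop.isPickup := h.sublist.countP_le
        _ ≤ I.cap := (I.countP_isPickup_serve F).trans_le (hFs F (by simp))
        _ ≤ p.countP Stop.isDelivery + I.cap := Nat.le_add_left _ _
    · have hq := ih (fun G hG => hFs G (List.mem_cons_of_mem _ hG)) h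
      rw [List.countP_append, List.countP_append, countP_isPickup_serve, countP_isDelivery_serve]
      omega

theorem isFeasible_algRoutes {T : I.Tours} (hT : I.IsMTSP T) {θ : Fin I.h → ℕ}
    (hθ : ∀ i, θ i ≤ I.cap) : I.IsFeasible (I.algRoutes T θ) where
  pickup_once j := by
    simp only [algRoutes_eq_flatMap_serve, count_pickup_flatMap_serve, flatten_algFragments, hT j]
  same_vehicle i j := by
    rw [algRoutes_eq_flatMap_serve, count_pickup_flatMap_serve, count_deliver_flatMap_serve]
  order i j p hp := by
    rw [algRoutes_eq_flatMap_serve] at hp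
    exact count_deliver_le_of_isPrefix hp j
  capacity i p hp := by
    rw [algRoutes_eq_flatMap_serve] at hp
    exact countP_isPickup_le_of_isPrefix (fun F => length_le_of_mem_algFragments (hθ i)) hp

/-! ### The expected weight of the routes -/

variable (I)

theorem walkWeight_wH_map_inr (L : List (Fin I.m)) :
    walkWeight I.wH (L.map Sum.inr) =
      walkWeight I.w (L.map I.src) + walkWeight I.w (L.map I.dst) := by
  rw [walkWeight_map, walkWeight_map, walkWeight_map, ← walkWeight_add]
  rfl

theorem map_loc_serve (B : List (Fin I.m)) :
    (I.serve B).map I.loc = B.map I.src ++ B.map I.dst := by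
  simp [serve, Function.comp_def, loc]

/-- Between the last source and the first destination the vehicle can be thought of as driving to
the last destination first, and then back to the first one. -/
theorem walkWeight_serve_le {B : List (Fin I.m)} (hB : B ≠ []) :
    walkWeight I.w ((I.serve B).map I.loc) ≤
      2 * walkWeight I.wH (B.map Sum.inr) + I.haul (B.getLast hB) := by
  have hsrc := walkWeight_nonneg I.w_nonneg (B.map I.src)
  have hback := dist_head_getLast_le I.w_self I.w_triangle (l := B.map I.dst) (by simpa)
  have htri := I.w_triangle (I.src (B.getLast hB)) (I.dst (B.getLast hB)) (I.dst (B.head hB))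
  rw [List.head_map, List.getLast_map, I.w_symm] at hback
  rw [map_loc_serve, walkWeight_append I.w (by simpa) (by simpa), List.getLast_map, List.head_map,
    walkWeight_wH_map_inr, haul]
  linarith

theorem walkWeight_flatMap_serve_le {Fs : List (List (Fin I.m))} (hFs : ∀ F ∈ Fs, F ≠ []) :
    walkWeight I.w ((Fs.flatMap I.serve).map I.loc) ≤
      2 * walkWeight I.wH (Fs.flatten.map Sum.inr) + 2 * (Fs.map (endValue I.haul)).sum := by
  induction Fs with
  | nil => simp
  | cons F Fs ih =>
    have hF := hFs F (by simp)
    have hserve := I.walkWeight_serve_le hF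
    have hhaul := I.haul_nonneg (F.getLast hF)
    rcases Fs with _ | ⟨G, Fs⟩
    · simp only [List.flatMap_cons, List.flatMap_nil, List.append_nil, List.flatten_cons,
        List.flatten_nil, List.map_cons, List.map_nil, List.sum_cons, List.sum_nil,
        endValue_eq _ hF]
      linarith
    have hG := hFs G (by simp)
    have htail := ih fun F hF' => hFs F (List.mem_cons_of_mem _ hF')
    have htri : I.w (I.dst (F.getLast hF)) (I.src (G.head hG)) ≤
        I.haul (F.getLast hF) + I.w (I.src (F.getLast hF)) (I.src (G.head hG)) := by
      rw [haul, I.w_symm (I.src (F.getLast hF)) (I.dst _)]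
      exact I.w_triangle _ _ _
    have hdst := I.w_nonneg (I.dst (F.getLast hF)) (I.dst (G.head hG))
    have hsrc := I.w_nonneg (I.src (F.getLast hF)) (I.src (G.head hG))
    have hroute : walkWeight I.w (((F :: G :: Fs).flatMap I.serve).map I.loc) =
        walkWeight I.w ((I.serve F).map I.loc) + I.w (I.dst (F.getLast hF)) (I.src (G.head hG)) +
          walkWeight I.w (((G :: Fs).flatMap I.serve).map I.loc) := by
      rw [List.flatMap_cons, List.map_append, walkWeight_append I.w (by simpa [map_loc_serve])
        (by simp [map_loc_serve, hG])]
      simp [map_loc_serve, hF, hG, List.getLast_append_of_ne_nil]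
    have htour : walkWeight I.wH ((F :: G :: Fs).flatten.map Sum.inr) =
        walkWeight I.wH (F.map Sum.inr) + (I.w (I.src (F.getLast hF)) (I.src (G.head hG)) +
          I.w (I.dst (F.getLast hF)) (I.dst (G.head hG))) +
          walkWeight I.wH ((G :: Fs).flatten.map Sum.inr) := by
      rw [List.flatten_cons, List.map_append, walkWeight_append I.wH (by simpa) (by simp [hG])]
      simp [hG, wH]
    rw [hroute, htour, List.map_cons, List.sum_cons, endValue_eq _ hF]
    linarith

theorem routeWeight_flatMap_serve_le (i : Fin I.h) {L : List (Fin I.m)} (hL : L ≠ [])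
    {Fs : List (List (Fin I.m))} (hFs : ∀ F ∈ Fs, F ≠ []) (hFL : Fs.flatten = L) {r : ℝ}
    (hr : (Fs.map (endValue I.haul)).sum ≤ r + endValue I.haul L) :
    I.routeWeight i (Fs.flatMap I.serve) ≤
      2 * tourWeight I.wH (Sum.inl i :: L.map Sum.inr) + 2 * r := by
  subst hFL
  have hweight := I.walkWeight_flatMap_serve_le hFs
  have hLm : Fs.flatten.map Sum.inr ≠ ([] : List (Fin I.h ⊕ Fin I.m)) := by simpa using hL
  have htour := tourWeight_cons I.wH (Sum.inl i) hLm
  rw [List.head_map, List.getLast_map] at htour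
  have htri := I.w_triangle (I.src (Fs.flatten.getLast hL)) (I.depot i)
    (I.dst (Fs.flatten.getLast hL))
  obtain ⟨F, Fs, rfl⟩ := List.exists_cons_of_ne_nil (show Fs ≠ [] by rintro rfl; simp at hL)
  have hF := hFs F (by simp)
  have hroute : I.routeWeight i ((F :: Fs).flatMap I.serve) = I.w (I.depot i) (I.src (F.head hF)) +
      walkWeight I.w (((F :: Fs).flatMap I.serve).map I.loc) := by
    rw [routeWeight, walkWeight_cons I.w _ (by simp [map_loc_serve, hF])]
    simp [map_loc_serve, hF]
  have hd := I.w_nonneg (I.depot i) (I.dst (F.head hF))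
  have hs := I.w_nonneg (I.depot i) (I.src (F.head hF))
  rw [endValue_eq _ hL, haul] at hr
  rw [I.w_symm _ (I.depot i)] at htri
  have hhead : (F :: Fs).flatten.head hL = F.head hF := by simp [hF]
  rw [hhead] at htour
  rw [hroute, htour, wH, wH]
  linarith

theorem routeWeight_algRoutes_le (T : I.Tours) (θ : Fin I.h → ℕ) (i : Fin I.h) (hθ : 1 ≤ θ i)
    (hθ' : θ i ≤ I.cap) :
    I.routeWeight i (I.algRoutes T θ i) ≤ 2 * tourWeight I.wH (Sum.inl i :: (T i).map Sum.inr) +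
      2 * residueSum I.haul (θ i : ZMod I.cap) (T i) := by
  rcases eq_or_ne (T i) [] with hT | hT
  · rw [algRoutes, hT]
    simp [serve, routeWeight, residueSum, tourWeight, wH, I.w_self]
  · rw [algRoutes_eq_flatMap_serve]
    refine I.routeWeight_flatMap_serve_le i hT
      (fun F hF => ne_nil_of_mem_algFragments hθ hT hF) (I.flatten_algFragments T θ i) ?_
    unfold algFragments
    split_ifs with h
    · simpa using residueSum_nonneg I.haul_nonneg (θ i : ZMod I.cap) (T i)
    · exact sum_endValue_fragments_le I.haul_nonneg I.cap_pos (by omega)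

theorem expect_comp_eval {ι κ : Type*} [Fintype ι] [DecidableEq ι] [Fintype κ] [Nonempty κ]
    (i : ι) (F : κ → ℝ) : (𝔼 θ : ι → κ, F (θ i)) = 𝔼 k, F k := by
  rw [Fintype.expect_equiv (Equiv.funSplitAt i κ) (fun θ => F (θ i)) (fun q => F q.1) fun _ => rfl,
    ← Finset.univ_product_univ, Finset.expect_product]
  simp only [Fintype.expect_const]

theorem expect_residueSum_haul (T : I.Tours) (i : Fin I.h) :
    (𝔼 θ : Fin I.h → Fin I.cap, residueSum I.haul ((θ i + 1 : ℕ) : ZMod I.cap) (T i)) =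
      ((T i).map I.haul).sum / I.cap := by
  have : NeZero I.cap := ⟨I.cap_pos.ne'⟩
  rw [expect_comp_eval i fun k : Fin I.cap => residueSum I.haul ((k + 1 : ℕ) : ZMod I.cap) (T i),
    Fintype.expect_eq_sum_div_card, sum_residueSum_natCast_succ, Fintype.card_fin]

variable {I}

theorem algExpectedWeight_le {T : I.Tours} (hT : I.IsMTSP T) :
    I.algExpectedWeight T ≤ 2 * I.mtspWeight T + 2 * ((∑ j, I.haul j) / I.cap) := by
  have : Nonempty (Fin I.cap) := ⟨⟨0, I.cap_pos⟩⟩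
  calc I.algExpectedWeight T
      ≤ 𝔼 θ : Fin I.h → Fin I.cap,
        ∑ i, (2 * tourWeight I.wH (Sum.inl i :: (T i).map Sum.inr) +
          2 * residueSum I.haul ((θ i + 1 : ℕ) : ZMod I.cap) (T i)) :=
        Finset.expect_le_expect fun θ _ => Finset.sum_le_sum fun i _ =>
          I.routeWeight_algRoutes_le T _ i (Nat.le_add_left _ _) (θ i).2
    _ = ∑ i, (2 * tourWeight I.wH (Sum.inl i :: (T i).map Sum.inr) +
          2 * (((T i).map I.haul).sum / I.cap)) := by
        simp only [Finset.expect_sum_comm, Finset.expect_add_distrib, Fintype.expect_const,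
          ← Finset.mul_expect, expect_residueSum_haul]
    _ = 2 * I.mtspWeight T + 2 * ((∑ j, I.haul j) / I.cap) := by
        rw [Finset.sum_add_distrib, ← Finset.mul_sum, ← Finset.mul_sum, ← Finset.sum_div,
          hT.sum_sum_map, mtspWeight]

theorem algExpectedWeight_le_mul_weight {T : I.Tours} (hT : I.IsTwoApproxMTSP T) {R : I.Routes}
    (hR : I.IsFeasible R) {k n : ℕ} (hk : I.cap ≤ k * k) (hn : I.m < 2 ^ n) :
    I.algExpectedWeight T ≤ (4 * ((4 * k + 4) * n + 4) + 2) * I.weight R := by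
  have hcap : (0 : ℝ) < I.cap := Nat.cast_pos.2 I.cap_pos
  obtain ⟨S, hS, hS_le⟩ := hR.exists_isMTSP hk hn
  have hhaul : (∑ j, I.haul j) / I.cap ≤ I.weight R := (div_le_iff₀' hcap).2 hR.sum_haul_le
  linarith [algExpectedWeight_le hT.1, hT.2 S hS]

theorem le_mul_opt {K x : ℝ} (hK : 0 ≤ K) (hne : ∃ R, I.IsFeasible R)
    (h : ∀ R, I.IsFeasible R → x ≤ K * I.weight R) : x ≤ K * I.opt := by
  obtain ⟨R₀, hR₀⟩ := hne
  rcases hK.eq_or_lt with rfl | hK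
  · simpa using h R₀ hR₀
  · rw [← div_le_iff₀' hK]
    refine le_csInf ⟨_, R₀, hR₀, rfl⟩ ?_
    rintro _ ⟨R, hR, rfl⟩
    exact (div_le_iff₀' hK).2 (h R hR)

theorem exists_sqrt_log_bound {c m : ℕ} (hc : 0 < c) (hm : 0 < m) :
    ∃ k n : ℕ, c ≤ k * k ∧ m < 2 ^ n ∧
      (4 * ((4 * k + 4) * n + 4) + 2 : ℝ) ≤ 200 * (√c * Real.log (m + 1)) := by
  have hs : 1 ≤ √(c : ℝ) := Real.one_le_sqrt.2 (by exact_mod_cast hc)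
  have hk : (Nat.sqrt c : ℝ) ≤ √(c : ℝ) := Real.nat_sqrt_le_real_sqrt
  have hm' : (1 : ℝ) ≤ m := by exact_mod_cast hm
  have hlog : Real.log 2 ≤ Real.log (m + 1) := Real.log_le_log two_pos (by linarith)
  have hlog_pow : (Nat.log 2 m : ℝ) * Real.log 2 ≤ Real.log (m + 1) := by
    rw [← Real.log_pow]
    refine Real.log_le_log (by positivity) ?_
    have hpow : (2 : ℝ) ^ Nat.log 2 m ≤ m := by exact_mod_cast Nat.pow_log_le_self 2 hm.ne'
    linarith
  have hlog_two := Real.log_two_gt_d9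
  set ℓ := Real.log (m + 1)
  have hn : (Nat.log 2 m + 1 : ℝ) ≤ 3 * ℓ := by
    nlinarith [Nat.cast_nonneg (α := ℝ) (Nat.log 2 m)]
  refine ⟨Nat.sqrt c + 1, Nat.log 2 m + 1, (Nat.lt_succ_sqrt c).le,
    Nat.lt_pow_succ_log_self one_lt_two m, ?_⟩
  push_cast
  have hprod : ((4 * (Nat.sqrt c + 1) + 4) * (Nat.log 2 m + 1) : ℝ) ≤ (12 * √c) * (3 * ℓ) :=
    mul_le_mul (by linarith) hn (by positivity) (by positivity)
  have hsℓ : ℓ ≤ √c * ℓ := le_mul_of_one_le_left (by linarith) hs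
  linarith

theorem algExpectedWeight_le_mul_opt {T : I.Tours} (hT : I.IsTwoApproxMTSP T) :
    I.algExpectedWeight T ≤ 200 * (√I.cap * Real.log (I.m + 1)) * I.opt := by
  have hlog : 0 ≤ Real.log (I.m + 1) := Real.log_nonneg (by simp)
  refine le_mul_opt (by positivity) ⟨_, isFeasible_algRoutes hT.1 fun _ => le_rfl⟩ fun R hR => ?_
  rcases Nat.eq_zero_or_pos I.m with hm | hm
  · have hempty : IsEmpty (Fin I.m) := by rw [hm]; infer_instance
    have hnil : ∀ i, T i = [] := fun i => List.eq_nil_iff_forall_not_mem.2 isEmptyElim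
    have hle := algExpectedWeight_le hT.1
    simpa [hm, mtspWeight, hnil, tourWeight, wH, I.w_self] using hle
  · obtain ⟨k, n, hk, hn, hkn⟩ := exists_sqrt_log_bound I.cap_pos hm
    exact (algExpectedWeight_le_mul_weight hT hR hk hn).trans
      (mul_le_mul_of_nonneg_right hkn (I.weight_nonneg R))

end Instance

/-! ### Prim's algorithm and the tours -/

section Linked

/-- The pointers `nx` chain the cells of the list, and the pointer of the last cell is `0`. -/
def Linked (nx : ℕ → ℕ) (l : List ℕ) : Prop := (l ++ [0]).IsChain fun x y => nx x = y

theorem linked_cons {nx : ℕ → ℕ} {x : ℕ} {l : List ℕ} :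
    Linked nx (x :: l) ↔ nx x = l.headD 0 ∧ Linked nx l := by
  cases l <;> simp [Linked]

theorem Linked.congr {nx nx' : ℕ → ℕ} {l : List ℕ} (h : ∀ x ∈ l, nx' x = nx x)
    (hl : Linked nx l) : Linked nx' l := by
  induction l with
  | nil => simp [Linked]
  | cons x l ih =>
    rw [linked_cons] at hl ⊢
    exact ⟨(h x (by simp)).trans hl.1, ih (fun y hy => h y (by simp [hy])) hl.2⟩

theorem Linked.insert {nx : ℕ → ℕ} {p q : ℕ} {l₁ l₂ : List ℕ} (hl : Linked nx (l₁ ++ p :: l₂))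
    (hnd : (l₁ ++ p :: l₂).Nodup) (hq : q ∉ l₁ ++ p :: l₂) :
    Linked (Function.update (Function.update nx q (nx p)) p q) (l₁ ++ p :: q :: l₂) := by
  induction l₁ with
  | nil =>
    simp only [List.nil_append, List.nodup_cons, List.mem_cons, not_or] at hnd hq
    rw [List.nil_append, linked_cons] at hl
    rw [List.nil_append, linked_cons, linked_cons]
    refine ⟨by simp, by simpa [hq.1] using hl.1, hl.2.congr fun x hx => ?_⟩
    rw [Function.update_of_ne (ne_of_mem_of_not_mem hx hnd.1),
      Function.update_of_ne (ne_of_mem_of_not_mem hx hq.2)]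
  | cons a l ih =>
    simp only [List.cons_append, List.nodup_cons, List.mem_cons, not_or] at hnd hq
    rw [List.cons_append, linked_cons] at hl ⊢
    refine ⟨?_, ih hl.2 hnd.2 hq.2⟩
    have hap : a ≠ p := fun h => hnd.1 (by simp [h])
    rw [Function.update_of_ne hap, Function.update_of_ne (Ne.symm hq.1), hl.1]
    cases l <;> rfl

end Linked

section Insertion

variable {α : Type*}

theorem exists_cons_eq_append_of_mem {q : α → Prop} {x y : α} {l : List α} (hy : ¬ q y)
    (hx : x ∈ l) (hqx : q x) :
    ∃ l₁ a b l₂, y :: l = l₁ ++ a :: b :: l₂ ∧ y ∈ l₁ ++ [a] ∧ ¬ q a ∧ q b := by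
  induction l generalizing y with
  | nil => simp at hx
  | cons z l ih =>
    by_cases hz : q z
    · exact ⟨[], y, z, l, rfl, by simp, hy, hz⟩
    · have hxl : x ∈ l := (List.mem_cons.1 hx).resolve_left fun h => hz (h ▸ hqx)
      obtain ⟨l₁, a, b, l₂, e, -, ha, hb⟩ := ih hz hxl
      exact ⟨y :: l₁, a, b, l₂, by rw [e, List.cons_append], by simp, ha, hb⟩

theorem exists_eq_append_of_mem_of_mem {q : α → Prop} {l : List α} {x y : α} (hx : x ∈ l)
    (hqx : q x) (hy : y ∈ l) (hqy : ¬ q y) :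
    ∃ l₁ a b l₂, l = l₁ ++ a :: b :: l₂ ∧
      (y ∈ l₁ ++ [a] ∧ ¬ q a ∧ q b ∨ y ∈ b :: l₂ ∧ q a ∧ ¬ q b) := by
  obtain ⟨k₁, k₂, rfl⟩ := List.append_of_mem hy
  have hxy : x ≠ y := by rintro rfl; exact hqy hqx
  rcases (by simpa [hxy] using hx : x ∈ k₁ ∨ x ∈ k₂) with h | h
  · obtain ⟨l₁, a, b, l₂, e, hyl, ha, hb⟩ :=
      exists_cons_eq_append_of_mem hqy (List.mem_reverse.2 h) hqx
    have e' : k₁ ++ [y] = l₂.reverse ++ b :: a :: l₁.reverse := by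
      simpa using congrArg List.reverse e
    refine ⟨l₂.reverse, b, a, l₁.reverse ++ k₂, ?_, Or.inr ⟨?_, hb, ha⟩⟩
    · simpa using congrArg (· ++ k₂) e'
    · simp only [List.mem_append, List.mem_cons, List.mem_reverse] at hyl ⊢
      tauto
  · obtain ⟨l₁, a, b, l₂, e, hyl, ha, hb⟩ := exists_cons_eq_append_of_mem hqy h hqx
    refine ⟨k₁ ++ l₁, a, b, l₂, by rw [e, List.append_assoc], Or.inl ⟨?_, ha, hb⟩⟩
    rw [List.append_assoc]
    exact List.mem_append_right _ hyl

theorem tourWeight_eq_walkWeight (d : α → α → ℝ) {l : List α} (hl : l ≠ []) :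
    tourWeight d l = walkWeight d (l ++ [l.head hl]) := by
  cases l with
  | nil => exact absurd rfl hl
  | cons x l => rfl

theorem tourWeight_insert_le {d : α → α → ℝ} (hs : ∀ a b, d a b = d b a)
    (ht : ∀ a b c, d a c ≤ d a b + d b c) (l₁ : List α) (p q : α) (l₂ : List α) :
    tourWeight d (l₁ ++ p :: q :: l₂) ≤ tourWeight d (l₁ ++ p :: l₂) + 2 * d p q := by
  obtain ⟨o, ho, ho'⟩ : ∃ o, (l₁ ++ p :: q :: l₂).head (by simp) = o ∧
      (l₁ ++ p :: l₂).head (by simp) = o := by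
    cases l₁ <;> simp
  obtain ⟨y, l, hy⟩ : ∃ y l, l₂ ++ [o] = y :: l := List.exists_cons_of_ne_nil (by simp)
  rw [tourWeight_eq_walkWeight d (by simp), tourWeight_eq_walkWeight d (by simp), ho, ho',
    List.append_assoc, List.append_assoc, List.cons_append, List.cons_append, List.cons_append, hy,
    walkWeight_append_cons_cons, walkWeight_append_cons_cons, walkWeight_cons_cons]
  linarith [ht q p y, hs q p]

end Insertion

namespace Instance

variable (I : Instance)

/-- In `H` a depot acts as a request whose source and destination coincide. -/
theorem wH_eq (a b : Fin I.h ⊕ Fin I.m) : I.wH a b =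
    I.w (Sum.elim I.depot I.src a) (Sum.elim I.depot I.src b) +
      I.w (Sum.elim I.depot I.dst a) (Sum.elim I.depot I.dst b) := by
  rcases a with a | a <;> rcases b with b | b <;> simp only [wH, Sum.elim_inl, Sum.elim_inr]
  · ring
  · rw [I.w_symm _ (I.depot b), I.w_symm _ (I.depot b)]

theorem wH_nonneg (a b : Fin I.h ⊕ Fin I.m) : 0 ≤ I.wH a b := by
  rw [wH_eq]
  exact add_nonneg (I.w_nonneg _ _) (I.w_nonneg _ _)

theorem wH_symm (a b : Fin I.h ⊕ Fin I.m) : I.wH a b = I.wH b a := by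
  rw [wH_eq, wH_eq, I.w_symm, I.w_symm (Sum.elim I.depot I.dst a)]

theorem wH_triangle (a b c : Fin I.h ⊕ Fin I.m) : I.wH a c ≤ I.wH a b + I.wH b c := by
  rw [wH_eq, wH_eq, wH_eq, add_add_add_comm]
  exact add_le_add (I.w_triangle _ _ _) (I.w_triangle _ _ _)

/-- The vertices of `H` that belong to the forest: all depots and the requests in `A`. -/
def InForest (A : Finset (Fin I.m)) : Fin I.h ⊕ Fin I.m → Prop :=
  Sum.elim (fun _ => True) (· ∈ A)

variable {I} in
theorem InForest.mono {A B : Finset (Fin I.m)} (h : A ⊆ B) {v : Fin I.h ⊕ Fin I.m}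
    (hv : I.InForest A v) : I.InForest B v := by
  rcases v with v | v
  · trivial
  · exact h hv

/-- The tour through depot `i` as a list of vertices of `H`. -/
def tourList (T : I.Tours) (i : Fin I.h) : List (Fin I.h ⊕ Fin I.m) :=
  Sum.inl i :: (T i).map Sum.inr

/-- The tours visit exactly the requests in `A`, each of them once. -/
def Covers (A : Finset (Fin I.m)) (T : I.Tours) : Prop :=
  ∀ j, ∑ i, (T i).count j = if j ∈ A then 1 else 0

variable {I}

section Covers

variable {A : Finset (Fin I.m)} {T : I.Tours}

theorem inr_mem_tourList {i : Fin I.h} {j : Fin I.m} :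
    Sum.inr j ∈ I.tourList T i ↔ j ∈ T i := by
  simp [tourList]

namespace Covers

variable (hT : I.Covers A T)

include hT

theorem mem_of_mem {i : Fin I.h} {j : Fin I.m} (hj : j ∈ T i) : j ∈ A := by
  by_contra hA
  have hsum := hT j
  rw [if_neg hA, Finset.sum_eq_zero_iff] at hsum
  exact List.count_eq_zero.1 (hsum i (Finset.mem_univ i)) hj

theorem exists_mem {j : Fin I.m} (hj : j ∈ A) : ∃ i, j ∈ T i := by
  have hsum := hT j
  rw [if_pos hj] at hsum
  obtain ⟨i, -, hi⟩ := Finset.exists_ne_zero_of_sum_ne_zero (hsum.trans_ne one_ne_zero)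
  exact ⟨i, List.count_pos_iff.1 (Nat.pos_of_ne_zero hi)⟩

theorem nodup_tourList (i : Fin I.h) : (I.tourList T i).Nodup := by
  refine List.nodup_cons.2 ⟨by simp, List.Nodup.map Sum.inr_injective ?_⟩
  refine List.nodup_iff_count_le_one.2 fun j => ?_
  refine (Finset.single_le_sum (f := fun i => (T i).count j) (fun _ _ => Nat.zero_le _)
    (Finset.mem_univ i)).trans ?_
  rw [hT]
  split_ifs <;> simp

theorem disjoint_tourList {i i' : Fin I.h} (hne : i ≠ i') :
    (I.tourList T i).Disjoint (I.tourList T i') := by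
  rintro (k | j) hv hv'
  · simp only [tourList, List.mem_cons, Sum.inl.injEq, List.mem_map, reduceCtorEq, and_false,
      exists_false, or_false] at hv hv'
    exact hne (hv.symm.trans hv')
  · rw [inr_mem_tourList, ← List.count_pos_iff] at hv hv'
    have hpair := Finset.sum_le_sum_of_subset (f := fun i => (T i).count j)
      (Finset.subset_univ {i, i'})
    rw [hT, Finset.sum_pair hne] at hpair
    split_ifs at hpair <;> omega

end Covers

end Covers

variable (I) in
/-- `T'` arises from `T` by inserting the request `j` behind the vertex `p` of `H`. -/
def IsInsertion (T T' : I.Tours) (p : Fin I.h ⊕ Fin I.m) (j : Fin I.m) : Prop :=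
  ∃ i l₁ l₂, I.tourList T i = l₁ ++ p :: l₂ ∧ I.tourList T' i = l₁ ++ p :: Sum.inr j :: l₂ ∧
    ∀ i', i' ≠ i → T' i' = T i'

theorem Covers.exists_isInsertion {A : Finset (Fin I.m)} {T : I.Tours} (hT : I.Covers A T)
    {p : Fin I.h ⊕ Fin I.m} (hp : I.InForest A p) (j : Fin I.m) :
    ∃ T', I.IsInsertion T T' p j := by
  rcases p with i | q
  · exact ⟨Function.update T i (j :: T i), i, [], _, rfl, by simp [tourList],
      fun i' hi' => Function.update_of_ne hi' _ _⟩
  · obtain ⟨i, hi⟩ := hT.exists_mem hp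
    obtain ⟨l₁, l₂, hl⟩ := List.append_of_mem hi
    exact ⟨Function.update T i (l₁ ++ q :: j :: l₂), i, Sum.inl i :: l₁.map Sum.inr,
      l₂.map Sum.inr, by simp [tourList, hl], by simp [tourList],
      fun i' hi' => Function.update_of_ne hi' _ _⟩

theorem IsInsertion.covers {A : Finset (Fin I.m)} {T T' : I.Tours} {p : Fin I.h ⊕ Fin I.m}
    {j : Fin I.m} (h : I.IsInsertion T T' p j) (hT : I.Covers A T) (hj : j ∉ A) :
    I.Covers (insert j A) T' := by
  obtain ⟨i, l₁, l₂, hl, hl', hne⟩ := h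
  have hperm : (T' i).Perm (j :: T i) := by
    refine (List.map_perm_map_iff Sum.inr_injective).1 (List.perm_cons (Sum.inl i) |>.1 ?_)
    change (I.tourList T' i).Perm (Sum.inl i :: Sum.inr j :: (T i).map Sum.inr)
    refine .trans ?_ (List.Perm.swap _ _ _)
    change (I.tourList T' i).Perm (Sum.inr j :: I.tourList T i)
    rw [hl, hl']
    simpa using List.perm_middle (l₁ := l₁ ++ [p]) (a := Sum.inr j) (l₂ := l₂)
  intro j'
  have hsum : ∑ i', (T' i').count j' = [j].count j' + ∑ i', (T i').count j' := by
    rw [← Finset.add_sum_erase _ _ (Finset.mem_univ i),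
      ← Finset.add_sum_erase _ (fun i => (T i).count j') (Finset.mem_univ i), hperm.count_eq,
      Finset.sum_congr rfl fun i' hi' => by rw [hne i' (Finset.ne_of_mem_erase hi')],
      ← List.singleton_append, List.count_append, add_assoc]
  rw [hsum, hT]
  by_cases e : j' = j
  · simp [e, hj]
  · simp [e, Ne.symm e]

theorem IsInsertion.mtspWeight_le {T T' : I.Tours} {p : Fin I.h ⊕ Fin I.m} {j : Fin I.m}
    (h : I.IsInsertion T T' p j) :
    I.mtspWeight T' ≤ I.mtspWeight T + 2 * I.wH p (Sum.inr j) := by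
  obtain ⟨i, l₁, l₂, hl, hl', hne⟩ := h
  have hi := tourWeight_insert_le I.wH_symm I.wH_triangle l₁ p (Sum.inr j) l₂
  rw [← hl, ← hl'] at hi
  unfold mtspWeight
  rw [← Finset.add_sum_erase _ _ (Finset.mem_univ i),
    ← Finset.add_sum_erase _ (fun i => tourWeight I.wH (Sum.inl i :: (T i).map Sum.inr))
      (Finset.mem_univ i),
    Finset.sum_congr rfl fun i' hi' => by rw [hne i' (Finset.ne_of_mem_erase hi')]]
  unfold tourList at hi
  linarith

variable (I)

/-- The number under which the program knows a vertex of `H`. -/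
def vertexId : Fin I.h ⊕ Fin I.m → ℕ := Sum.elim (fun i => i) fun j => I.h + j

theorem vertexId_injective : Function.Injective I.vertexId := by
  rintro (a | a) (b | b) h <;> simp only [vertexId, Sum.elim_inl, Sum.elim_inr] at h
  · rw [Fin.ext h]
  · omega
  · omega
  · rw [Fin.ext (Nat.add_left_cancel h)]

/-- The pointers `nx` chain the vertices of every tour. -/
def IsLinked (nx : ℕ → ℕ) (T : I.Tours) : Prop :=
  ∀ i, Linked nx ((I.tourList T i).map I.vertexId)

theorem isLinked_empty : I.IsLinked (fun _ => 0) fun _ => [] := fun i => by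
  simp [tourList, Linked]

variable {I} in
theorem IsInsertion.isLinked {A : Finset (Fin I.m)} {T T' : I.Tours} {p : Fin I.h ⊕ Fin I.m}
    {j : Fin I.m} (h : I.IsInsertion T T' p j) (hT : I.Covers A T) (hj : j ∉ A) {nx : ℕ → ℕ}
    (hnx : I.IsLinked nx T) :
    I.IsLinked (Function.update (Function.update nx (I.vertexId (Sum.inr j)) (nx (I.vertexId p)))
      (I.vertexId p) (I.vertexId (Sum.inr j))) T' := by
  obtain ⟨i, l₁, l₂, hl, hl', hne⟩ := h
  have hmem {v : Fin I.h ⊕ Fin I.m} {i'} :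
      I.vertexId v ∈ (I.tourList T i').map I.vertexId ↔ v ∈ I.tourList T i' :=
    List.mem_map_of_injective I.vertexId_injective
  have hjT (i') : I.vertexId (Sum.inr j) ∉ (I.tourList T i').map I.vertexId := by
    rw [hmem, inr_mem_tourList]
    exact fun hji => hj (hT.mem_of_mem hji)
  intro i'
  by_cases e : i' = i
  · subst e
    have hlinked := hnx i'
    have hnodup := (hT.nodup_tourList i').map I.vertexId_injective
    have hjl := hjT i'
    rw [hl, List.map_append, List.map_cons] at hlinked hnodup hjl
    rw [hl', List.map_append, List.map_cons, List.map_cons]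
    exact hlinked.insert hnodup hjl
  · have hp : I.vertexId p ∉ (I.tourList T i').map I.vertexId := by
      rw [hmem]
      exact hT.disjoint_tourList (Ne.symm e) (by simp [hl])
    rw [show I.tourList T' i' = I.tourList T i' by rw [tourList, hne i' e, tourList]]
    refine (hnx i').congr fun x hx => ?_
    rw [Function.update_of_ne (ne_of_mem_of_not_mem hx hp),
      Function.update_of_ne (ne_of_mem_of_not_mem hx (hjT i'))]

/-- With the paths `Ps` the requests outside of `A` can be connected to the forest. -/
structure IsCompletion (A : Finset (Fin I.m)) (Ps : Multiset (List (Fin I.h ⊕ Fin I.m))) :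
    Prop where
  meets_forest : ∀ P ∈ Ps, ∃ v ∈ P, I.InForest A v
  exists_path : ∀ j, j ∉ A → ∃ P ∈ Ps, Sum.inr j ∈ P

variable {I}

theorem isCompletion_tourList {S : I.Tours} (hS : I.IsMTSP S) :
    I.IsCompletion ∅ (Finset.univ.val.map (I.tourList S)) where
  meets_forest P hP := by
    obtain ⟨i, -, rfl⟩ := Multiset.mem_map.1 hP
    exact ⟨Sum.inl i, by simp [tourList], trivial⟩
  exists_path j _ := by
    have hcov : I.Covers Finset.univ S := fun j => by simpa using hS j
    obtain ⟨i, hi⟩ := hcov.exists_mem (Finset.mem_univ j)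
    exact ⟨_, Multiset.mem_map_of_mem _ (Finset.mem_univ i), inr_mem_tourList.2 hi⟩

theorem IsCompletion.split {A B : Finset (Fin I.m)} (hAB : A ⊆ B)
    {P Q : List (Fin I.h ⊕ Fin I.m)} {Ps : Multiset (List (Fin I.h ⊕ Fin I.m))}
    (h : I.IsCompletion A ((P ++ Q) ::ₘ Ps)) (hP : ∃ v ∈ P, I.InForest B v)
    (hQ : ∃ v ∈ Q, I.InForest B v) : I.IsCompletion B (P ::ₘ Q ::ₘ Ps) where
  meets_forest R hR := by
    rcases Multiset.mem_cons.1 hR with rfl | hR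
    · exact hP
    rcases Multiset.mem_cons.1 hR with rfl | hR
    · exact hQ
    obtain ⟨v, hv, hvA⟩ := h.meets_forest R (Multiset.mem_cons_of_mem hR)
    exact ⟨v, hv, hvA.mono hAB⟩
  exists_path j hj := by
    obtain ⟨R, hR, hjR⟩ := h.exists_path j fun hA => hj (hAB hA)
    rcases Multiset.mem_cons.1 hR with rfl | hR
    · rcases List.mem_append.1 hjR with hj' | hj'
      · exact ⟨P, by simp, hj'⟩
      · exact ⟨Q, by simp, hj'⟩
    · exact ⟨R, by simp [hR], hjR⟩

/-- The path to `j` crosses the boundary of the forest; cut it at such an edge. -/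
theorem IsCompletion.exists_insert {A : Finset (Fin I.m)}
    {Ps : Multiset (List (Fin I.h ⊕ Fin I.m))} (h : I.IsCompletion A Ps) {j : Fin I.m} (hj : j ∉ A)
    {δ : ℝ} (hmin : ∀ u, I.InForest A u → ∀ j', j' ∉ A → δ ≤ I.wH u (Sum.inr j')) :
    ∃ Qs, I.IsCompletion (insert j A) Qs ∧
      δ + (Qs.map (walkWeight I.wH)).sum ≤ (Ps.map (walkWeight I.wH)).sum := by
  obtain ⟨P, hP, hjP⟩ := h.exists_path j hj
  obtain ⟨x, hxP, hx⟩ := h.meets_forest P hP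
  obtain ⟨Qs, rfl⟩ := Multiset.exists_cons_of_mem hP
  obtain ⟨P₁, a, b, P₂, rfl, hcut⟩ := exists_eq_append_of_mem_of_mem hxP hx hjP hj
  have hsub : A ⊆ insert j A := Finset.subset_insert _ _
  have hjF : I.InForest (insert j A) (Sum.inr j) := Finset.mem_insert_self _ _
  have hpieces : (∃ v ∈ P₁ ++ [a], I.InForest (insert j A) v) ∧
      (∃ v ∈ b :: P₂, I.InForest (insert j A) v) ∧ δ ≤ I.wH a b := by
    rcases hcut with ⟨hjmem, ha, hb⟩ | ⟨hjmem, ha, hb⟩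
    · refine ⟨⟨_, hjmem, hjF⟩, ⟨b, by simp, hb.mono hsub⟩, ?_⟩
      rcases a with a | a
      · exact absurd trivial ha
      · rw [I.wH_symm]
        exact hmin b hb a ha
    · refine ⟨⟨a, by simp, ha.mono hsub⟩, ⟨_, hjmem, hjF⟩, ?_⟩
      rcases b with b | b
      · exact absurd trivial hb
      · exact hmin a ha b hb
  obtain ⟨hP₁, hP₂, hδ⟩ := hpieces
  refine ⟨(P₁ ++ [a]) ::ₘ (b :: P₂) ::ₘ Qs, ?_, ?_⟩
  · exact IsCompletion.split hsub (by rwa [← List.append_cons]) hP₁ hP₂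
  · simp only [Multiset.map_cons, Multiset.sum_cons, walkWeight_append_cons_cons]
    linarith

variable (I)

/-- An intermediate result of the algorithm, with tours through the depots and the requests in `A`:
`c` is the weight of the part of a minimum spanning forest that has been constructed, and the
forest can still be completed at no more than the cost of any family of tours in `H`. -/
structure IsPartialSolution (A : Finset (Fin I.m)) (T : I.Tours) (c : ℝ) : Prop where
  covers : I.Covers A T
  weight_le : I.mtspWeight T ≤ 2 * c
  completion : ∀ S, I.IsMTSP S →
    ∃ Ps, I.IsCompletion A Ps ∧ c + (Ps.map (walkWeight I.wH)).sum ≤ I.mtspWeight S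

theorem isPartialSolution_empty : I.IsPartialSolution ∅ (fun _ => []) 0 where
  covers j := by simp
  weight_le := by simp [mtspWeight, tourWeight, wH, I.w_self]
  completion S hS := by
    refine ⟨_, isCompletion_tourList hS, ?_⟩
    rw [zero_add, Multiset.map_map]
    exact Finset.sum_le_sum fun i _ => walkWeight_le_of_isPrefix I.wH_nonneg ⟨[Sum.inl i], rfl⟩

variable {I}

theorem IsPartialSolution.isTwoApproxMTSP {T : I.Tours} {c : ℝ}
    (h : I.IsPartialSolution Finset.univ T c) : I.IsTwoApproxMTSP T := by
  refine ⟨fun j => by simpa using h.covers j, fun S hS => ?_⟩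
  obtain ⟨Ps, -, hc⟩ := h.completion S hS
  have hPs : 0 ≤ (Ps.map (walkWeight I.wH)).sum := Multiset.sum_nonneg fun x hx => by
    obtain ⟨P, -, rfl⟩ := Multiset.mem_map.1 hx
    exact walkWeight_nonneg I.wH_nonneg P
  linarith [h.weight_le]

theorem IsPartialSolution.exists_insert {A : Finset (Fin I.m)} {T : I.Tours} {c : ℝ}
    (hT : I.IsPartialSolution A T c) {nx : ℕ → ℕ} (hnx : I.IsLinked nx T) {j : Fin I.m} (hj : j ∉ A)
    {p : Fin I.h ⊕ Fin I.m} (hp : I.InForest A p)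
    (hmin : ∀ u, I.InForest A u → ∀ j', j' ∉ A → I.wH p (Sum.inr j) ≤ I.wH u (Sum.inr j')) :
    ∃ T', I.IsPartialSolution (insert j A) T' (c + I.wH p (Sum.inr j)) ∧
      I.IsLinked (Function.update (Function.update nx (I.vertexId (Sum.inr j))
        (nx (I.vertexId p))) (I.vertexId p) (I.vertexId (Sum.inr j))) T' := by
  obtain ⟨T', hins⟩ := hT.covers.exists_isInsertion hp j
  refine ⟨T', ⟨hins.covers hT.covers hj, ?_, fun S hS => ?_⟩, hins.isLinked hT.covers hj hnx⟩
  · linarith [hins.mtspWeight_le, hT.weight_le]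
  · obtain ⟨Ps, hPs, hc⟩ := hT.completion S hS
    obtain ⟨Qs, hQs, hQc⟩ := hPs.exists_insert hj hmin
    exact ⟨Qs, hQs, by linarith⟩

end Instance

/-! ### Reasoning about programs -/

namespace State

@[simp] theorem writeN_nat (s : State) (a i x b j : ℕ) :
    (s.writeN a i x).nat b j = if b = a ∧ j = i then x else s.nat b j := by
  by_cases hb : b = a
  · subst hb
    by_cases hj : j = i <;> simp [writeN, hj]
  · simp [writeN, hb]

theorem writeN_nat_of_ne {s : State} {a i x b : ℕ} (h : b ≠ a) :
    (s.writeN a i x).nat b = s.nat b :=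
  Function.update_of_ne h _ _

@[simp] theorem writeN_real (s : State) (a i x : ℕ) : (s.writeN a i x).real = s.real := rfl

@[simp] theorem writeR_nat (s : State) (a i : ℕ) (x : ℝ) : (s.writeR a i x).nat = s.nat := rfl

@[simp] theorem writeR_real (s : State) (a i : ℕ) (x : ℝ) (b j : ℕ) :
    (s.writeR a i x).real b j = if b = a ∧ j = i then x else s.real b j := by
  by_cases hb : b = a
  · subst hb
    by_cases hj : j = i <;> simp [writeR, hj]
  · simp [writeR, hb]

@[simp] theorem popTape_nat (s : State) : s.popTape.nat = s.nat := rfl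

end State

namespace Cmd

/-- The arrays of natural numbers to which a program contains a write access. -/
def writesN : Cmd → List ℕ
  | skip => []
  | setN a _ _ => [a]
  | setR _ _ _ => []
  | draw a _ => [a]
  | seq p q => p.writesN ++ q.writesN
  | ite _ p q => p.writesN ++ q.writesN
  | loop _ p => p.writesN

/-- The program does not draw random numbers. -/
def DrawFree : Cmd → Prop
  | skip => True
  | setN _ _ _ => True
  | setR _ _ _ => True
  | draw _ _ => False
  | seq p q => p.DrawFree ∧ q.DrawFree
  | ite _ p q => p.DrawFree ∧ q.DrawFree
  | loop _ p => p.DrawFree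

/-- The program does not write real numbers. -/
def RealFree : Cmd → Prop
  | skip => True
  | setN _ _ _ => True
  | setR _ _ _ => False
  | draw _ _ => True
  | seq p q => p.RealFree ∧ q.RealFree
  | ite _ p q => p.RealFree ∧ q.RealFree
  | loop _ p => p.RealFree

end Cmd

namespace Exec

variable {D : ℕ → ℕ → ℝ} {p : Cmd} {s s' : State} {t : ℕ}

theorem nat_eq (h : Exec D p s s' t) {a : ℕ} (ha : a ∉ p.writesN) : s'.nat a = s.nat a := by
  induction h with
  | skip | setR => rfl
  | setN s b i e =>
    have hab : a ≠ b := by simpa [Cmd.writesN] using ha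
    funext j
    simp [hab]
  | draw s b i =>
    have hab : a ≠ b := by simpa [Cmd.writesN] using ha
    funext j
    simp [hab]
  | seq _ _ ih₁ ih₂ =>
    simp only [Cmd.writesN, List.mem_append, not_or] at ha
    rw [ih₂ ha.2, ih₁ ha.1]
  | ite_true _ _ ih =>
    simp only [Cmd.writesN, List.mem_append, not_or] at ha
    exact ih ha.1
  | ite_false _ _ ih =>
    simp only [Cmd.writesN, List.mem_append, not_or] at ha
    exact ih ha.2
  | loop_done => rfl
  | loop_step _ _ _ ih₁ ih₂ => rw [ih₂ ha, ih₁ ha]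

theorem tape_eq (h : Exec D p s s' t) (hp : p.DrawFree) : s'.tape = s.tape := by
  induction h with
  | skip | setR | setN => rfl
  | draw => exact hp.elim
  | seq _ _ ih₁ ih₂ => rw [ih₂ hp.2, ih₁ hp.1]
  | ite_true _ _ ih => exact ih hp.1
  | ite_false _ _ ih => exact ih hp.2
  | loop_done => rfl
  | loop_step _ _ _ ih₁ ih₂ => rw [ih₂ hp, ih₁ hp]

theorem real_eq (h : Exec D p s s' t) (hp : p.RealFree) : s'.real = s.real := by
  induction h with
  | skip | setN | draw => rfl
  | setR => exact hp.elim
  | seq _ _ ih₁ ih₂ => rw [ih₂ hp.2, ih₁ hp.1]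
  | ite_true _ _ ih => exact ih hp.1
  | ite_false _ _ ih => exact ih hp.2
  | loop_done => rfl
  | loop_step _ _ _ ih₁ ih₂ => rw [ih₂ hp, ih₁ hp]

end Exec

/-- The same memory with the random tape `ω`. -/
def State.retape (s : State) (ω : ℕ → ℕ) : State := { s with tape := ω }

theorem NExp.eval_retape (s : State) (ω : ℕ → ℕ) (e : NExp) : e.eval (s.retape ω) = e.eval s := by
  induction e with
  | const k => rfl
  | read a i ih => simp only [NExp.eval, ih]; rfl
  | add e f ih₁ ih₂ | sub e f ih₁ ih₂ => simp only [NExp.eval, ih₁, ih₂]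

theorem RExp.eval_retape (D : ℕ → ℕ → ℝ) (s : State) (ω : ℕ → ℕ) (e : RExp) :
    e.eval D (s.retape ω) = e.eval D s := by
  induction e with
  | read a i => simp only [RExp.eval, NExp.eval_retape]; rfl
  | dist u v => simp only [RExp.eval, NExp.eval_retape]
  | add e f ih₁ ih₂ | sub e f ih₁ ih₂ => simp only [RExp.eval, ih₁, ih₂]

theorem Test.holds_retape (D : ℕ → ℕ → ℝ) (s : State) (ω : ℕ → ℕ) (b : Test) :
    b.Holds D (s.retape ω) ↔ b.Holds D s := by
  induction b with
  | ltN e f => simp only [Test.Holds, NExp.eval_retape]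
  | ltR e f => simp only [Test.Holds, RExp.eval_retape]
  | neg b ih => simp only [Test.Holds, ih]
  | conj b c ih₁ ih₂ => simp only [Test.Holds, ih₁, ih₂]

theorem Exec.retape {D : ℕ → ℕ → ℝ} {p : Cmd} {s s' : State} {t : ℕ} (h : Exec D p s s' t)
    (hp : p.DrawFree) (ω : ℕ → ℕ) : Exec D p (s.retape ω) (s'.retape ω) t := by
  induction h with
  | skip s => exact .skip _
  | setN s a i e =>
    have h := Exec.setN (D := D) (s.retape ω) a i e
    rwa [NExp.eval_retape, NExp.eval_retape] at h
  | setR s a i e =>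
    have h := Exec.setR (D := D) (s.retape ω) a i e
    rwa [NExp.eval_retape, RExp.eval_retape] at h
  | draw => exact hp.elim
  | seq _ _ ih₁ ih₂ => exact .seq (ih₁ hp.1) (ih₂ hp.2)
  | ite_true hb _ ih => exact .ite_true ((Test.holds_retape D _ ω _).2 hb) (ih hp.1)
  | ite_false hb _ ih =>
    exact .ite_false (fun h => hb ((Test.holds_retape D _ ω _).1 h)) (ih hp.2)
  | loop_done hb => exact .loop_done fun h => hb ((Test.holds_retape D _ ω _).1 h)
  | loop_step hb _ _ ih₁ ih₂ =>
    exact .loop_step ((Test.holds_retape D _ ω _).2 hb) (ih₁ hp) (ih₂ hp)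

/-- Total correctness: started in the state `s`, the program halts, and its final state and its
running time satisfy `Q`. -/
def Halts (D : ℕ → ℕ → ℝ) (p : Cmd) (s : State) (Q : State → ℕ → Prop) : Prop :=
  ∃ s' t, Exec D p s s' t ∧ Q s' t

namespace Halts

variable {D : ℕ → ℕ → ℝ} {p q : Cmd} {b : Test} {s : State} {Q Q' : State → ℕ → Prop}

theorem skip (h : Q s 1) : Halts D .skip s Q := ⟨_, _, .skip s, h⟩

theorem setN {a : ℕ} {i e : NExp}
    (h : Q (s.writeN a (i.eval s) (e.eval s)) (i.cost + e.cost + 1)) : Halts D (.setN a i e) s Q :=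
  ⟨_, _, .setN s a i e, h⟩

theorem setR {a : ℕ} {i : NExp} {e : RExp}
    (h : Q (s.writeR a (i.eval s) (e.eval D s)) (i.cost + e.cost + 1)) :
    Halts D (.setR a i e) s Q :=
  ⟨_, _, .setR s a i e, h⟩

theorem draw {a : ℕ} {i : NExp}
    (h : Q (s.writeN a (i.eval s) (s.tape 0)).popTape (i.cost + 1)) : Halts D (.draw a i) s Q :=
  ⟨_, _, .draw s a i, h⟩

theorem seq (h : Halts D p s fun s' t => Halts D q s' fun s'' u => Q s'' (t + u)) :
    Halts D (.seq p q) s Q := by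
  obtain ⟨s₁, t, h₁, s₂, u, h₂, hQ⟩ := h
  exact ⟨s₂, t + u, .seq h₁ h₂, hQ⟩

theorem ite (h₁ : b.Holds D s → Halts D p s fun s' t => Q s' (b.cost + t + 1))
    (h₂ : ¬ b.Holds D s → Halts D q s fun s' t => Q s' (b.cost + t + 1)) :
    Halts D (.ite b p q) s Q := by
  by_cases hb : b.Holds D s
  · obtain ⟨s', t, h, hQ⟩ := h₁ hb
    exact ⟨s', _, .ite_true hb h, hQ⟩
  · obtain ⟨s', t, h, hQ⟩ := h₂ hb
    exact ⟨s', _, .ite_false hb h, hQ⟩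

theorem loop_done (hb : ¬ b.Holds D s) (h : Q s (b.cost + 1)) : Halts D (.loop b p) s Q :=
  ⟨_, _, .loop_done hb, h⟩

theorem loop_step (hb : b.Holds D s)
    (h : Halts D p s fun s' t => Halts D (.loop b p) s' fun s'' u => Q s'' (b.cost + t + u + 1)) :
    Halts D (.loop b p) s Q := by
  obtain ⟨s₁, t, h₁, s₂, u, h₂, hQ⟩ := h
  exact ⟨s₂, _, .loop_step hb h₁ h₂, hQ⟩

theorem mono (h : Halts D p s Q) (hQ : ∀ s' t, Q s' t → Q' s' t) : Halts D p s Q' := by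
  obtain ⟨s', t, h, hq⟩ := h
  exact ⟨s', t, h, hQ _ _ hq⟩

theorem frame (h : Halts D p s Q)
    (hQ : ∀ s' t, Q s' t → (∀ a, a ∉ p.writesN → s'.nat a = s.nat a) →
      (p.RealFree → s'.real = s.real) → (p.DrawFree → s'.tape = s.tape) → Q' s' t) :
    Halts D p s Q' := by
  obtain ⟨s', t, h, hq⟩ := h
  exact ⟨s', t, h, hQ _ _ hq (fun _ ha => h.nat_eq ha) h.real_eq h.tape_eq⟩

theorem loop (Inv : ℕ → State → Prop) (n c : ℕ)
    (hstep : ∀ k < n, ∀ s, Inv k s → b.Holds D s ∧ Halts D p s fun s' t => Inv (k + 1) s' ∧ t ≤ c)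
    (hend : ∀ s, Inv n s → ¬ b.Holds D s) (h₀ : Inv 0 s) :
    Halts D (.loop b p) s fun s' t => Inv n s' ∧ t ≤ n * (c + b.cost + 1) + (b.cost + 1) := by
  suffices hrounds : ∀ r k s, k + r = n → Inv k s →
      Halts D (.loop b p) s fun s' t => Inv n s' ∧ t ≤ r * (c + b.cost + 1) + (b.cost + 1) from
    hrounds n 0 s (Nat.zero_add n) h₀
  intro r
  induction r with
  | zero =>
    rintro k s hk hI
    obtain rfl : k = n := by omega
    exact loop_done (hend s hI) ⟨hI, by omega⟩
  | succ r ih =>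
    rintro k s hk hI
    obtain ⟨hb, hp⟩ := hstep k (by omega) s hI
    refine loop_step hb (hp.mono ?_)
    rintro s' t ⟨hI', ht⟩
    refine (ih (k + 1) s' (by omega) hI').mono ?_
    rintro s'' u ⟨hI'', hu⟩
    exact ⟨hI'', by rw [Nat.succ_mul]; omega⟩

end Halts

/-! ### The program: spanning forest and tours -/

/-- Assignment to a variable, which is kept in the first entry of an array. -/
def assign (x : ℕ) (e : NExp) : Cmd := .setN x (.const 0) e

/-- The value of a variable. -/
def scalar (x : ℕ) : NExp := .read x (.const 0)

/-- The number `h` of vehicles in the input. -/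
def numVehicles : NExp := .read 0 (.const 1)

/-- The number `m` of requests in the input. -/
def numRequests : NExp := .read 0 (.const 2)

/-- The capacity `cap` in the input. -/
def capacity : NExp := .read 0 (.const 3)

/-- `for x < n do p` -/
def forLoop (x : ℕ) (n : NExp) (p : Cmd) : Cmd :=
  .seq (assign x (.const 0)) <|
  .loop (.ltN (scalar x) n) (.seq p (assign x (.add (scalar x) (.const 1))))

namespace Cell

/-- Input array: the sources of the requests. -/
abbrev src : ℕ := 1

/-- Input array: the destinations of the requests. -/
abbrev dst : ℕ := 2

/-- Input array: the initial locations of the vehicles. -/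
abbrev depot : ℕ := 3

/-- Output variable: the length of the output. -/
abbrev outLength : ℕ := 4

/-- Output array. -/
abbrev out : ℕ := 5

/-- Array: the successor of every vertex on its tour, `0` at the end of the tour. -/
abbrev next : ℕ := 6

/-- Array: for every request, its nearest vertex in the forest, increased by one; `0` as long as the
forest is empty. -/
abbrev nearest : ℕ := 7

/-- Array of real numbers: for every request, its distance from the forest. -/
abbrev dist : ℕ := 0

/-- Array: `1` for every request that belongs to the forest. -/
abbrev marked : ℕ := 8

/-- Variable: the vertex of the forest to which a request is attached. -/
abbrev anchor : ℕ := 9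

/-- Variable: the vertex that is being added to the forest. -/
abbrev vertex : ℕ := 10

/-- Variable: the first location of the vertex that is being added to the forest. -/
abbrev fst : ℕ := 11

/-- Variable: the second location of the vertex that is being added to the forest. -/
abbrev snd : ℕ := 12

/-- Variable: counter of the inner loops over the requests. -/
abbrev request : ℕ := 13

/-- Variable: counter of the outer loops. -/
abbrev round : ℕ := 14

/-- Variable: the nearest request outside of the forest. -/
abbrev best : ℕ := 15

end Cell

/-- The distance in `H` of the current request from the vertex that is being added. -/
def distance : RExp :=
  .add (.dist (scalar Cell.fst) (.read Cell.src (scalar Cell.request)))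
    (.dist (scalar Cell.snd) (.read Cell.dst (scalar Cell.request)))

/-- Update the nearest vertex of the current request. -/
def relaxStep : Cmd :=
  .ite (.conj (.ltN (.const 0) (.read Cell.nearest (scalar Cell.request)))
      (.neg (.ltR distance (.read Cell.dist (scalar Cell.request)))))
    .skip
    (.seq (.setR Cell.dist (scalar Cell.request) distance) <|
      .setN Cell.nearest (scalar Cell.request) (.add (scalar Cell.vertex) (.const 1)))

/-- Update the nearest vertices of all requests. -/
def relax : Cmd := forLoop Cell.request numRequests relaxStep

/-- Replace the best request by the current one if the latter is a better choice. -/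
def selectStep : Cmd :=
  .ite (.conj (.neg (.ltN (.const 0) (.read Cell.marked (scalar Cell.request))))
      (.neg (.conj (.ltN (scalar Cell.best) numRequests)
        (.neg (.ltR (.read Cell.dist (scalar Cell.request))
          (.read Cell.dist (scalar Cell.best)))))))
    (assign Cell.best (scalar Cell.request))
    .skip

/-- Find the request outside of the forest that is nearest to the forest. -/
def select : Cmd :=
  .seq (assign Cell.best numRequests) (forLoop Cell.request numRequests selectStep)

/-- Add the best request to the forest, and to the tours directly behind its nearest vertex. -/
def attach : Cmd :=
  .seq (assign Cell.anchor (.sub (.read Cell.nearest (scalar Cell.best)) (.const 1))) <|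
  .seq (assign Cell.vertex (.add numVehicles (scalar Cell.best))) <|
  .seq (.setN Cell.next (scalar Cell.vertex) (.read Cell.next (scalar Cell.anchor))) <|
  .seq (.setN Cell.next (scalar Cell.anchor) (scalar Cell.vertex)) <|
  .seq (.setN Cell.marked (scalar Cell.best) (.const 1)) <|
  .seq (assign Cell.fst (.read Cell.src (scalar Cell.best))) <|
  assign Cell.snd (.read Cell.dst (scalar Cell.best))

/-- Start the forest with the depots. -/
def addDepots : Cmd :=
  forLoop Cell.round numVehicles
    (.seq (assign Cell.vertex (scalar Cell.round)) <|
      .seq (assign Cell.fst (.read Cell.depot (scalar Cell.round))) <|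
      .seq (assign Cell.snd (.read Cell.depot (scalar Cell.round))) relax)

/-- Prim's algorithm, once the depots form the forest. -/
def addRequests : Cmd := forLoop Cell.round numRequests (.seq select (.seq attach relax))

attribute [local simp] assign scalar numVehicles numRequests capacity NExp.eval RExp.eval Test.Holds
  NExp.cost RExp.cost Test.cost

theorem Halts.assign {D : ℕ → ℕ → ℝ} {s : State} {Q : State → ℕ → Prop} {x : ℕ} {e : NExp}
    (h : Q (s.writeN x 0 (e.eval s)) (e.cost + 2)) : Halts D (MDaRP.assign x e) s Q :=
  .setN (by rwa [NExp.cost, Nat.add_comm 1, NExp.eval])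

theorem Halts.forLoop {D : ℕ → ℕ → ℝ} {x : ℕ} {e : NExp} {p : Cmd} {s : State}
    (hx : x ∉ p.writesN) (Inv : ℕ → State → Prop) (n c : ℕ) (he : ∀ k s, Inv k s → e.eval s = n)
    (hInv : ∀ k s y, Inv k s → Inv k (s.writeN x 0 y))
    (hstep : ∀ k < n, ∀ s, Inv k s → s.nat x 0 = k →
      Halts D p s fun s' t => Inv (k + 1) s' ∧ t ≤ c)
    (h₀ : Inv 0 s) :
    Halts D (MDaRP.forLoop x e p) s fun s' t =>
      Inv n s' ∧ t ≤ n * (c + e.cost + 10) + e.cost + 7 := by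
  refine .seq (.assign (Halts.mono
    (.loop (fun k s => Inv k s ∧ s.nat x 0 = k) n (c + 6) ?_ ?_ ⟨hInv _ _ _ h₀, by simp⟩) ?_))
  · rintro k hk s ⟨hI, hk'⟩
    refine ⟨by simp [hk', he k s hI, hk], .seq ((hstep k hk s hI hk').frame ?_)⟩
    rintro s' t ⟨hI', ht⟩ hfr - -
    refine .assign ⟨⟨hInv _ _ _ hI', ?_⟩, ?_⟩
    · simp [hfr x hx, hk']
    · simp only [scalar, NExp.cost]
      omega
  · rintro s ⟨hI, hn⟩
    simp [hn, he n s hI]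
  · rintro s' t ⟨⟨hI, -⟩, ht⟩
    refine ⟨hI, ?_⟩
    simp only [Test.cost, scalar, NExp.cost] at ht ⊢
    have hn : n * (c + 6 + (1 + 1 + e.cost + 1) + 1) = n * (c + e.cost + 10) := by ring
    omega

theorem setOf_val_lt_succ {n k : ℕ} (hk : k < n) :
    {i : Fin n | (i : ℕ) < k + 1} = insert ⟨k, hk⟩ {i : Fin n | (i : ℕ) < k} := by
  ext i
  simp [Fin.ext_iff, le_iff_eq_or_lt]

/-- The outcome of a search for a minimum of `f` on `B`. -/
def IsArgmin {α β : Type*} [Preorder β] (f : α → β) (B : Set α) : Option α → Prop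
  | none => B = ∅
  | some p => p ∈ B ∧ IsMinOn f B p

namespace IsArgmin

variable {α β : Type*} [Preorder β] {f : α → β} {B : Set α}

theorem insert_self {o : Option α} (h : IsArgmin f B o) {v : α} (hv : ∀ p ∈ o, f v ≤ f p) :
    IsArgmin f (insert v B) (some v) := by
  refine ⟨Set.mem_insert v B, ?_⟩
  rintro u (rfl | hu)
  · exact le_refl (f u)
  · rcases o with _ | p
    · exact absurd (h ▸ hu : u ∈ (∅ : Set α)) (Set.notMem_empty u)
    · exact (hv p rfl).trans (h.2 hu)

theorem insert_of_le {p : α} (h : IsArgmin f B (some p)) {v : α} (hv : f p ≤ f v) :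
    IsArgmin f (insert v B) (some p) := by
  refine ⟨Set.mem_insert_of_mem v h.1, ?_⟩
  rintro u (rfl | hu)
  · exact hv
  · exact h.2 hu

end IsArgmin

namespace Instance

variable (I : Instance)

/-- The input arrays are unchanged. -/
def HasInput (s : State) : Prop := ∀ a < 4, s.nat a = (I.initState fun _ => 0).nat a

namespace HasInput

variable {I} {s : State} (hs : I.HasInput s)

include hs

theorem numVehicles : s.nat 0 1 = I.h := by rw [hs 0 (by decide)]; rfl

theorem numRequests : s.nat 0 2 = I.m := by rw [hs 0 (by decide)]; rfl

theorem capacity : s.nat 0 3 = I.cap := by rw [hs 0 (by decide)]; rfl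

theorem src (j : Fin I.m) : s.nat Cell.src j = I.src j := by
  rw [hs Cell.src (by decide)]; simp [initState]

theorem dst (j : Fin I.m) : s.nat Cell.dst j = I.dst j := by
  rw [hs Cell.dst (by decide)]; simp [initState]

theorem depot (i : Fin I.h) : s.nat Cell.depot i = I.depot i := by
  rw [hs Cell.depot (by decide)]; simp [initState]

theorem frame {s' : State} {p : Cmd} (hp : ∀ a ∈ p.writesN, 4 ≤ a)
    (hfr : ∀ a, a ∉ p.writesN → s'.nat a = s.nat a) : I.HasInput s' :=
  fun a ha => (hfr a fun h => (hp a h).not_gt ha).trans (hs a ha)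

theorem writeN {a : ℕ} (ha : 4 ≤ a) (i x : ℕ) : I.HasInput (s.writeN a i x) :=
  fun _ hb => (State.writeN_nat_of_ne (hb.trans_le ha).ne).trans (hs _ hb)

end HasInput

theorem table_eq (a b : Fin I.n) : I.table a b = I.w a b := by simp [table]

/-- The variables describe the vertex `v` of `H`. -/
structure HasVertex (s : State) (v : Fin I.h ⊕ Fin I.m) : Prop where
  vertex : s.nat Cell.vertex 0 = I.vertexId v
  fst : s.nat Cell.fst 0 = Sum.elim I.depot I.src v
  snd : s.nat Cell.snd 0 = Sum.elim I.depot I.dst v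

variable {I} in
theorem HasVertex.congr {s s' : State} {v : Fin I.h ⊕ Fin I.m} (hv : I.HasVertex s v)
    (h : ∀ a, Cell.vertex ≤ a → a ≤ Cell.snd → s'.nat a = s.nat a) : I.HasVertex s' v where
  vertex := by rw [h _ (by decide) (by decide), hv.vertex]
  fst := by rw [h _ (by decide) (by decide), hv.fst]
  snd := by rw [h _ (by decide) (by decide), hv.snd]

/-- The request `j` knows its nearest vertex in `B`. -/
def HasNearest (s : State) (B : Set (Fin I.h ⊕ Fin I.m)) (j : Fin I.m) : Prop :=
  ∃ o, IsArgmin (fun u => I.wH u (Sum.inr j)) B o ∧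
    s.nat Cell.nearest j = o.elim 0 (fun p => I.vertexId p + 1) ∧
    ∀ p ∈ o, s.real Cell.dist j = I.wH p (Sum.inr j)

variable {I} in
theorem HasNearest.congr {s s' : State} {B : Set (Fin I.h ⊕ Fin I.m)} {j : Fin I.m}
    (h : I.HasNearest s B j) (hnear : s'.nat Cell.nearest j = s.nat Cell.nearest j)
    (hdist : s'.real Cell.dist j = s.real Cell.dist j) : I.HasNearest s' B j := by
  rwa [HasNearest, hnear, hdist]

theorem eval_distance {s : State} (hs : I.HasInput s) {v : Fin I.h ⊕ Fin I.m}
    (hv : I.HasVertex s v) {j : Fin I.m} (hj : s.nat Cell.request 0 = j) :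
    distance.eval I.table s = I.wH v (Sum.inr j) := by
  simp only [distance, RExp.eval, scalar, NExp.eval, hv.fst, hv.snd, hj, hs.src, hs.dst, table_eq,
    wH_eq, Sum.elim_inr]

theorem halts_relaxStep {s : State} (hs : I.HasInput s) {v : Fin I.h ⊕ Fin I.m}
    (hv : I.HasVertex s v) {j : Fin I.m} (hj : s.nat Cell.request 0 = j)
    {B : Set (Fin I.h ⊕ Fin I.m)} (hB : I.HasNearest s B j) :
    Halts I.table relaxStep s fun s' t => I.HasNearest s' (insert v B) j ∧
      (∀ j' : Fin I.m, j' ≠ j → s'.nat Cell.nearest j' = s.nat Cell.nearest j' ∧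
        s'.real Cell.dist j' = s.real Cell.dist j') ∧ t ≤ 60 := by
  have hdist := I.eval_distance hs hv hj
  obtain ⟨o, ho, hnear, hod⟩ := hB
  refine .ite (fun hb => .skip ⟨?_, fun _ _ => ⟨rfl, rfl⟩, by decide⟩)
    fun hb => .seq (.setR (.setN ⟨?_, fun j' hj' => ?_, by decide⟩))
  · simp only [Test.Holds, RExp.eval, NExp.eval, scalar, hj, hnear, hdist, not_lt] at hb
    rcases o with _ | p
    · exact absurd hb.1 (lt_irrefl 0)
    · exact ⟨some p, ho.insert_of_le (hod p rfl ▸ hb.2), hnear, hod⟩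
  · refine ⟨some v, ho.insert_self fun p hp => ?_, ?_, ?_⟩
    · obtain rfl : o = some p := hp
      simp only [Test.Holds, RExp.eval, NExp.eval, scalar, hj, hnear, hdist, hod p rfl,
        Option.elim_some, Nat.succ_pos, true_and, not_not] at hb
      exact hb.le
    · simp [hj, hv.vertex]
    · rintro p ⟨⟩
      simp [hj, hdist]
  · have hne : (j' : ℕ) ≠ j := Fin.val_ne_of_ne hj'
    simp [hj, hne]

theorem halts_relax {s : State} (hs : I.HasInput s) {v : Fin I.h ⊕ Fin I.m}
    (hv : I.HasVertex s v) {B : Set (Fin I.h ⊕ Fin I.m)} (hB : ∀ j, I.HasNearest s B j) :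
    Halts I.table relax s fun s' t =>
      (∀ j, I.HasNearest s' (insert v B) j) ∧ t ≤ 100 * I.m + 100 := by
  refine (Halts.forLoop (by decide) (fun k s => I.HasInput s ∧ I.HasVertex s v ∧
    ∀ j : Fin I.m, I.HasNearest s (if (j : ℕ) < k then insert v B else B) j) I.m 60
    ?_ ?_ ?_ ⟨hs, hv, by simpa using hB⟩).mono ?_
  · exact fun _ _ hI => hI.1.numRequests
  · rintro k s y ⟨hs, hv, hB⟩
    refine ⟨hs.writeN (by decide) _ _, hv.congr fun a _ ha => State.writeN_nat_of_ne ?_,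
      fun j => (hB j).congr (by simp) rfl⟩
    exact (ha.trans_lt (by decide)).ne
  · rintro k hk s ⟨hs, hv, hB⟩ hk'
    refine (I.halts_relaxStep hs hv (j := ⟨k, hk⟩) hk' (by simpa using hB ⟨k, hk⟩)).frame ?_
    rintro s' t ⟨hnear, hother, ht⟩ hfr - -
    refine ⟨⟨hs.frame (by decide) hfr, hv.congr fun a ha _ => hfr a fun h => ?_, fun j => ?_⟩, ht⟩
    · exact ha.not_gt ((by decide : ∀ a ∈ relaxStep.writesN, a < Cell.vertex) a h)
    · by_cases hj : j = ⟨k, hk⟩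
      · subst hj
        simpa using hnear
      · have hjk : (j : ℕ) < k + 1 ↔ (j : ℕ) < k := by
          rw [Nat.lt_succ_iff, le_iff_lt_or_eq, or_iff_left fun h => hj (Fin.ext h)]
        simp only [hjk]
        exact (hB j).congr (hother j hj).1 (hother j hj).2
  · rintro s' t ⟨⟨-, -, hB⟩, ht⟩
    refine ⟨fun j => by simpa using hB j, ht.trans ?_⟩
    simp only [MDaRP.numRequests, NExp.cost]
    omega

theorem halts_addDepots {s : State} (hs : I.HasInput s) (hnear : ∀ j, s.nat Cell.nearest j = 0) :
    Halts I.table addDepots s fun s' t => I.HasInput s' ∧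
      (∀ j, I.HasNearest s' {v | I.InForest ∅ v} j) ∧ t ≤ I.h * (100 * I.m + 200) + 100 := by
  refine (Halts.forLoop (by decide) (fun k s => I.HasInput s ∧
    ∀ j, I.HasNearest s (Sum.inl '' {i : Fin I.h | (i : ℕ) < k}) j) I.h (100 * I.m + 150)
    ?_ ?_ ?_ ⟨hs, fun j => ⟨none, by simp [IsArgmin], hnear j, by simp⟩⟩).mono ?_
  · exact fun _ _ hI => hI.1.numVehicles
  · exact fun k s y hI =>
      ⟨hI.1.writeN (by decide) _ _, fun j => (hI.2 j).congr (by simp) rfl⟩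
  · rintro k hk s ⟨hs, hB⟩ hk'
    have hd : s.nat Cell.depot k = _ := hs.depot ⟨k, hk⟩
    refine .seq (.assign (.seq (.assign (.seq (.assign ((I.halts_relax (v := Sum.inl ⟨k, hk⟩)
      (((hs.writeN ?_ _ _).writeN ?_ _ _).writeN ?_ _ _) ⟨?_, ?_, ?_⟩
      fun j => (hB j).congr (by simp) rfl).frame ?_))))))
    iterate 3 decide
    iterate 3 simp [hk', hd, vertexId]
    rintro s' t ⟨hN, ht⟩ hfr - -
    refine ⟨⟨HasInput.frame (p := relax) ?_ (by decide) hfr, fun j => ?_⟩, ?_⟩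
    · exact ((hs.writeN (by decide) _ _).writeN (by decide) _ _).writeN (by decide) _ _
    · rw [setOf_val_lt_succ hk, Set.image_insert_eq]
      exact hN j
    · simp only [scalar, NExp.cost]
      omega
  · rintro s' t ⟨⟨hs', hB⟩, ht⟩
    refine ⟨hs', fun j => ?_, ht.trans ?_⟩
    · convert hB j using 1
      ext (i | j) <;> simp [InForest]
    · simp only [MDaRP.numVehicles, NExp.cost]
      nlinarith

/-- The variable `Cell.best` holds the result of the search for a nearest request in `C`. -/
def HasBest (s : State) (C : Set (Fin I.m)) : Prop :=
  ∃ o, IsArgmin (fun j : Fin I.m => s.real Cell.dist j) C o ∧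
    s.nat Cell.best 0 = o.elim I.m Fin.val

/-- The marked requests are those in `A`. -/
def HasMarked (s : State) (A : Finset (Fin I.m)) : Prop :=
  ∀ j : Fin I.m, s.nat Cell.marked j = if j ∈ A then 1 else 0

theorem halts_selectStep {A : Finset (Fin I.m)} {s : State} (hs : I.HasInput s)
    (hA : I.HasMarked s A) {j : Fin I.m} (hj : s.nat Cell.request 0 = j) {C : Set (Fin I.m)}
    (hC : I.HasBest s C) :
    Halts I.table selectStep s fun s' t =>
      I.HasBest s' (if j ∈ A then C else insert j C) ∧ t ≤ 50 := by
  obtain ⟨o, ho, hbest⟩ := hC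
  have hmark := hA j
  refine .ite (fun hb => .assign ⟨?_, by decide⟩) fun hb => .skip ⟨?_, by decide⟩
  · simp only [Test.Holds, RExp.eval, NExp.eval, scalar, hj, hmark, MDaRP.numRequests,
      hs.numRequests, hbest] at hb
    have hjA : j ∉ A := fun h => by simp [h] at hb
    rw [if_neg hjA]
    refine ⟨some j, ho.insert_self fun p hp => ?_, by simp [hj]⟩
    obtain rfl : o = some p := hp
    have hlt := hb.2
    simp only [Option.elim_some, p.2, true_and, not_not] at hlt
    exact hlt.le
  · split_ifs with hjA
    · exact ⟨o, ho, hbest⟩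
    · rcases o with _ | p
      · simp [hj, hmark, hjA, hs.numRequests, hbest] at hb
      · simp only [Test.Holds, RExp.eval, NExp.eval, scalar, hj, hmark, hjA, MDaRP.numRequests,
          hs.numRequests, hbest, Option.elim_some, p.2, if_false, lt_self_iff_false,
          not_false_eq_true, true_and, not_not, not_lt] at hb
        exact ⟨some p, ho.insert_of_le hb, hbest⟩

theorem halts_select {A : Finset (Fin I.m)} {s : State} (hs : I.HasInput s)
    (hA : I.HasMarked s A) :
    Halts I.table select s fun s' t => I.HasBest s' {j | j ∉ A} ∧ t ≤ 100 * I.m + 100 := by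
  refine .seq (.assign ((Halts.forLoop (by decide) (fun k s => I.HasInput s ∧ I.HasMarked s A ∧
    I.HasBest s {j | (j : ℕ) < k ∧ j ∉ A}) I.m 50 ?_ ?_ ?_
    ⟨hs.writeN (by decide) _ _, ?_, none, ?_, ?_⟩).mono ?_))
  · exact fun _ _ hI => hI.1.numRequests
  · rintro k s y ⟨hs, hA, hB⟩
    exact ⟨hs.writeN (by decide) _ _, fun j => by simpa using hA j, by simpa [HasBest] using hB⟩
  · rintro k hk s ⟨hs, hA, hB⟩ hk'
    refine (I.halts_selectStep hs hA (j := ⟨k, hk⟩) hk' hB).frame ?_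
    rintro s' t ⟨hB', ht⟩ hfr - -
    refine ⟨⟨hs.frame (by decide) hfr, fun j => ?_, ?_⟩, ht⟩
    · rw [hfr Cell.marked (by decide), hA]
    · convert hB' using 1
      rw [Set.ofPred_and, setOf_val_lt_succ hk]
      split_ifs with h
      · rw [Set.insert_inter_of_notMem (by simpa using h)]
        rfl
      · rw [Set.insert_inter_of_mem (by simpa using h)]
        rfl
  · exact fun j => by simpa using hA j
  · simp [IsArgmin]
  · simp [hs.numRequests]
  · rintro s' t ⟨⟨-, -, hB⟩, ht⟩
    refine ⟨by simpa using hB, ?_⟩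
    simp only [MDaRP.numRequests, NExp.cost] at ht ⊢
    omega

theorem halts_attach {s : State} (hs : I.HasInput s) {b : Fin I.m} (hb : s.nat Cell.best 0 = b)
    {p : Fin I.h ⊕ Fin I.m} (hp : s.nat Cell.nearest b = I.vertexId p + 1) :
    Halts I.table attach s fun s' t => I.HasVertex s' (Sum.inr b) ∧
      s'.nat Cell.next = Function.update (Function.update (s.nat Cell.next)
        (I.vertexId (Sum.inr b)) (s.nat Cell.next (I.vertexId p)))
        (I.vertexId p) (I.vertexId (Sum.inr b)) ∧
      s'.nat Cell.marked = Function.update (s.nat Cell.marked) b 1 ∧ t ≤ 100 := by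
  refine .seq (.assign (.seq (.assign (.seq (.setN (.seq (.setN (.seq (.setN (.seq (.assign
    (.assign ⟨⟨?_, ?_, ?_⟩, ?_, ?_, by decide⟩))))))))))))
  · simp [hs.numVehicles, hb, vertexId]
  · simp [hb, hs.src]
  · simp [hb, hs.dst]
  · funext x
    simp [hs.numVehicles, hb, hp, vertexId, Function.update_apply]
  · funext x
    simp [hb, Function.update_apply]

/-- The state between two rounds of Prim's algorithm, with the requests in `A` in the forest. -/
structure HasForest (s : State) (A : Finset (Fin I.m)) (T : I.Tours) : Prop where
  isPartialSolution : ∃ c, I.IsPartialSolution A T c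
  isLinked : I.IsLinked (s.nat Cell.next) T
  hasMarked : I.HasMarked s A
  hasNearest : ∀ j, I.HasNearest s {v | I.InForest A v} j

variable {I}

theorem HasForest.writeN {s : State} {A : Finset (Fin I.m)} {T : I.Tours} (h : I.HasForest s A T)
    {a : ℕ} (ha : Cell.marked < a) (i x : ℕ) : I.HasForest (s.writeN a i x) A T where
  isPartialSolution := h.isPartialSolution
  isLinked := by
    rw [State.writeN_nat_of_ne ((by decide : Cell.next ≤ Cell.marked).trans_lt ha).ne]
    exact h.isLinked
  hasMarked j := by
    rw [State.writeN_nat_of_ne ha.ne]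
    exact h.hasMarked j
  hasNearest j := (h.hasNearest j).congr (by
    rw [State.writeN_nat_of_ne ((by decide : Cell.nearest ≤ Cell.marked).trans_lt ha).ne]) rfl

theorem setOf_inForest_insert (A : Finset (Fin I.m)) (b : Fin I.m) :
    {v | I.InForest (insert b A) v} = insert (Sum.inr b) {v | I.InForest A v} := by
  ext (i | j) <;> simp [InForest]

/-- The nearest vertices known to the requests and the best request are the endpoints of a shortest
edge that leaves the forest. -/
theorem HasNearest.exists_shortest {s : State} {A : Finset (Fin I.m)}
    (hnear : ∀ j, I.HasNearest s {v | I.InForest A v} j) (hbest : I.HasBest s {j | j ∉ A})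
    (hA : A.card < I.m) :
    ∃ b p, s.nat Cell.best 0 = (b : Fin I.m) ∧ s.nat Cell.nearest b = I.vertexId p + 1 ∧ b ∉ A ∧
      I.InForest A p ∧
      ∀ u, I.InForest A u → ∀ j, j ∉ A → I.wH p (Sum.inr b) ≤ I.wH u (Sum.inr j) := by
  have hsome (j : Fin I.m) : ∃ p, I.InForest A p ∧ s.nat Cell.nearest j = I.vertexId p + 1 ∧
      s.real Cell.dist j = I.wH p (Sum.inr j) ∧
      ∀ u, I.InForest A u → I.wH p (Sum.inr j) ≤ I.wH u (Sum.inr j) := by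
    obtain ⟨_ | p, ho, hj, hd⟩ := hnear j
    · have hdepot : Sum.inl ⟨0, I.h_pos⟩ ∈ {v | I.InForest A v} := trivial
      exact absurd (ho ▸ hdepot) (Set.notMem_empty _)
    · exact ⟨p, ho.1, hj, hd p rfl, ho.2⟩
  obtain ⟨_ | b, ho, hb⟩ := hbest
  · have huniv : A = Finset.univ := Finset.eq_univ_of_forall fun j => by
      by_contra hj
      exact (ho ▸ hj : j ∈ (∅ : Set (Fin I.m)))
    simp [huniv] at hA
  · obtain ⟨p, hp, hnp, hdp, -⟩ := hsome b
    refine ⟨b, p, hb, hnp, ho.1, hp, fun u hu j hj => ?_⟩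
    obtain ⟨q, -, -, hdq, hq⟩ := hsome j
    calc I.wH p (Sum.inr b) = s.real Cell.dist b := hdp.symm
      _ ≤ s.real Cell.dist j := ho.2 hj
      _ = I.wH q (Sum.inr j) := hdq
      _ ≤ I.wH u (Sum.inr j) := hq u hu

theorem HasForest.halts_addRequest {A : Finset (Fin I.m)} (hA : A.card < I.m) {T : I.Tours}
    {s : State} (hs : I.HasInput s) (hT : I.HasForest s A T) :
    Halts I.table (.seq select (.seq attach relax)) s fun s' t =>
      (∃ A' T', A'.card = A.card + 1 ∧ I.HasForest s' A' T') ∧ t ≤ 200 * I.m + 300 := by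
  refine .seq ((I.halts_select hs hT.hasMarked).frame ?_)
  rintro s₁ t₁ ⟨hbest, ht₁⟩ hfr₁ hreal₁ -
  have hs₁ : I.HasInput s₁ := hs.frame (by decide) hfr₁
  have hnear₁ (j : Fin I.m) : I.HasNearest s₁ {v | I.InForest A v} j :=
    (hT.hasNearest j).congr (by rw [hfr₁ _ (by decide)]) (by rw [hreal₁ (by repeat' constructor)])
  obtain ⟨b, p, hb, hp, hbA, hpA, hmin⟩ := HasNearest.exists_shortest hnear₁ hbest hA
  refine .seq ((I.halts_attach hs₁ hb hp).frame ?_)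
  rintro s₂ t₂ ⟨hv₂, hnext₂, hmark₂, ht₂⟩ hfr₂ hreal₂ -
  refine (I.halts_relax (hs₁.frame (by decide) hfr₂) hv₂ fun j => (hnear₁ j).congr
    (by rw [hfr₂ _ (by decide)]) (by rw [hreal₂ (by repeat' constructor)])).frame ?_
  rintro s₃ t₃ ⟨hnear₃, ht₃⟩ hfr₃ - -
  obtain ⟨c, hpart⟩ := hT.isPartialSolution
  obtain ⟨T', hT', hlink⟩ := hpart.exists_insert hT.isLinked hbA hpA hmin
  refine ⟨⟨insert b A, T', Finset.card_insert_of_notMem hbA, ⟨_, hT'⟩, ?_, fun j => ?_, ?_⟩,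
    by omega⟩
  · rwa [hfr₃ _ (by decide), hnext₂, hfr₁ _ (by decide)]
  · rw [hfr₃ _ (by decide), hmark₂, hfr₁ _ (by decide), Function.update_apply, hT.hasMarked]
    simp only [Finset.mem_insert, Fin.val_inj]
    split_ifs <;> simp_all
  · rwa [setOf_inForest_insert]

variable (I)

theorem halts_addRequests {s : State} (hs : I.HasInput s) {T : I.Tours} (hT : I.HasForest s ∅ T) :
    Halts I.table addRequests s fun s' t => I.HasInput s' ∧
      (∃ T', I.HasForest s' Finset.univ T') ∧ t ≤ I.m * (200 * I.m + 400) + 100 := by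
  refine (Halts.forLoop (by decide) (fun k s => I.HasInput s ∧
    ∃ A T, A.card = k ∧ I.HasForest s A T) I.m (200 * I.m + 300) ?_ ?_ ?_
    ⟨hs, ∅, T, Finset.card_empty, hT⟩).mono ?_
  · exact fun _ _ hI => hI.1.numRequests
  · rintro k s y ⟨hs, A, T, hA, hT⟩
    exact ⟨hs.writeN (by decide) _ _, A, T, hA, hT.writeN (by decide) _ _⟩
  · rintro _ hk s ⟨hs, A, T, rfl, hT⟩ -
    refine (hT.halts_addRequest hk hs).frame ?_
    exact fun s' t h hfr _ _ => ⟨⟨hs.frame (by decide) hfr, h.1⟩, h.2⟩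
  · rintro s' t ⟨⟨hs', A, T', hA, hT'⟩, ht⟩
    obtain rfl : A = Finset.univ := (Finset.card_eq_iff_eq_univ A).1 (by rw [hA, Fintype.card_fin])
    refine ⟨hs', ⟨T', hT'⟩, ht.trans ?_⟩
    simp only [MDaRP.numRequests, NExp.cost]
    linarith [Nat.zero_le I.m]

theorem halts_tours (ω : ℕ → ℕ) :
    Halts I.table (.seq addDepots addRequests) (I.initState ω) fun s t => I.HasInput s ∧
      (∃ T, I.IsTwoApproxMTSP T ∧ I.IsLinked (s.nat Cell.next) T) ∧ s.nat Cell.outLength 0 = 0 ∧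
        t ≤ I.h * (100 * I.m + 200) + I.m * (200 * I.m + 400) + 200 := by
  refine .seq ((I.halts_addDepots (s := I.initState ω) (fun _ _ => rfl) fun _ => rfl).frame ?_)
  rintro s₁ t₁ ⟨hs₁, hnear, ht₁⟩ hfr₁ - -
  refine (I.halts_addRequests hs₁ (T := fun _ => []) ⟨⟨0, I.isPartialSolution_empty⟩, ?_, ?_,
    hnear⟩).frame ?_
  · rw [hfr₁ _ (by decide)]
    exact I.isLinked_empty
  · intro j
    rw [hfr₁ _ (by decide)]
    rfl
  · rintro s₂ t₂ ⟨hs₂, ⟨T, hT⟩, ht₂⟩ hfr₂ - -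
    obtain ⟨c, hc⟩ := hT.isPartialSolution
    refine ⟨hs₂, ⟨T, hc.isTwoApproxMTSP, hT.isLinked⟩, ?_, by omega⟩
    rw [hfr₂ _ (by decide), hfr₁ _ (by decide)]
    rfl

end Instance

/-! ### The program: cutting the tours and writing the routes -/

namespace Cell

/-- Variable: the current vertex on a walk along a tour, `0` at the end of the tour. -/
abbrev cursor : ℕ := 16

/-- Variable: the first vertex of the current fragment, `0` at the end of the tour. -/
abbrev fragment : ℕ := 17

/-- Variable: the number of steps that remain on a walk along a tour. -/
abbrev count : ℕ := 18

/-- Variable: the size of the current fragment. -/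
abbrev size : ℕ := 19

end Cell

/-- Append a number to the output. -/
def emit (e : NExp) : Cmd :=
  .seq (.setN Cell.out (scalar Cell.outLength) e) <|
  assign Cell.outLength (.add (scalar Cell.outLength) (.const 1))

/-- Three times the number of the request at the cursor, plus `c`. The machine cannot multiply. -/
def stopCode (c : ℕ) : NExp :=
  .add (.add (.sub (scalar Cell.cursor) numVehicles)
    (.add (.sub (scalar Cell.cursor) numVehicles) (.sub (scalar Cell.cursor) numVehicles)))
    (.const c)

/-- Do `p` at every vertex of a walk along a tour. -/
def walk (p : Cmd) : Cmd :=
  .loop (.conj (.ltN (.const 0) (scalar Cell.count)) (.ltN (.const 0) (scalar Cell.cursor)))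
    (.seq p <|
      .seq (assign Cell.cursor (.read Cell.next (scalar Cell.cursor))) <|
      assign Cell.count (.sub (scalar Cell.count) (.const 1)))

/-- Do `p` for the next `n` requests of the tour, starting with the current fragment. -/
def pass (n : NExp) (p : Cmd) : Cmd :=
  .seq (assign Cell.count n) <| .seq (assign Cell.cursor (scalar Cell.fragment)) <| walk p

/-- Write the route through one fragment: all pickups, then all deliveries. -/
def writeFragment : Cmd :=
  .seq (pass (scalar Cell.size) (emit (stopCode 2))) <|
  .seq (pass (scalar Cell.size) (emit (stopCode 3))) <|
  .seq (assign Cell.fragment (scalar Cell.cursor)) <|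
  assign Cell.size capacity

/-- Write the routes through the remaining fragments of the tour. -/
def writeFragments : Cmd := .loop (.ltN (.const 0) (scalar Cell.fragment)) writeFragment

/-- Do not cut a tour that has at most `cap` requests. -/
def adjustSize : Cmd :=
  .seq (pass capacity .skip) <|
  .ite (.ltN (.const 0) (scalar Cell.cursor)) .skip (assign Cell.size capacity)

/-- Write the route of one vehicle, given its offset. -/
def writeTour : Cmd :=
  .seq (assign Cell.fragment (.read Cell.next (scalar Cell.round))) <|
  .seq adjustSize <| .seq writeFragments <| emit (.const 0)

/-- Draw the offset of one vehicle and write its route. -/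
def writeRoute : Cmd := .seq (.draw Cell.size (.const 0)) writeTour

/-- The whole algorithm. -/
def algorithm : Cmd :=
  .seq (.seq addDepots addRequests) (forLoop Cell.round numVehicles writeRoute)

/-- The output consists of the word `W`. -/
def HasOutput (s : State) (W : List ℕ) : Prop :=
  s.nat Cell.outLength 0 = W.length ∧ ∀ k (hk : k < W.length), s.nat Cell.out k = W[k]

theorem HasOutput.congr {s s' : State} {W : List ℕ} (h : HasOutput s W)
    (hlen : s'.nat Cell.outLength = s.nat Cell.outLength)
    (hout : s'.nat Cell.out = s.nat Cell.out) : HasOutput s' W := by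
  rwa [HasOutput, hlen, hout]

theorem HasOutput.writeN {s : State} {W : List ℕ} (h : HasOutput s W) {a : ℕ} (ha : Cell.out < a)
    (i x : ℕ) : HasOutput (s.writeN a i x) W :=
  h.congr (State.writeN_nat_of_ne ((by decide : Cell.outLength < Cell.out).trans ha).ne)
    (State.writeN_nat_of_ne ha.ne)

theorem halts_emit {D : ℕ → ℕ → ℝ} {s : State} {W : List ℕ} (hW : HasOutput s W) (e : NExp) :
    Halts D (emit e) s fun s' t => HasOutput s' (W ++ [e.eval s]) ∧ t ≤ e.cost + 10 := by
  refine .seq (.setN (.assign ⟨⟨?_, fun k hk => ?_⟩, ?_⟩))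
  · simp [hW.1]
  · rw [List.length_append, List.length_singleton] at hk
    rcases (Nat.lt_succ_iff.1 hk).eq_or_lt with rfl | h
    · simp [hW.1]
    · rw [List.getElem_append_left h, ← hW.2 k h]
      simp [hW.1, h.ne]
  · simp only [scalar, NExp.cost]
    omega

namespace Instance

variable (I : Instance)

/-- The pointers `nx` lead from `c` through the requests in `L`. -/
def Points (nx : ℕ → ℕ) (c : ℕ) (L : List (Fin I.m)) : Prop :=
  c = (L.map fun j => I.vertexId (Sum.inr j)).headD 0 ∧
    Linked nx (L.map fun j => I.vertexId (Sum.inr j))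

variable {I}

theorem IsLinked.points {nx : ℕ → ℕ} {T : I.Tours} (h : I.IsLinked nx T) (i : Fin I.h) :
    I.Points nx (nx i) (T i) := by
  have hi := h i
  rwa [tourList, List.map_cons, List.map_map, linked_cons] at hi

theorem points_cons {nx : ℕ → ℕ} {c : ℕ} {j : Fin I.m} {L : List (Fin I.m)} :
    I.Points nx c (j :: L) ↔ c = I.vertexId (Sum.inr j) ∧ I.Points nx (nx c) L := by
  rw [Points, List.map_cons, linked_cons, List.headD_cons]
  exact and_congr_right fun h => by rw [Points, h]

theorem vertexId_inr_pos (j : Fin I.m) : 0 < I.vertexId (Sum.inr j) :=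
  Nat.add_pos_left I.h_pos _

theorem Points.pos_iff {nx : ℕ → ℕ} {c : ℕ} {L : List (Fin I.m)} (h : I.Points nx c L) :
    0 < c ↔ L ≠ [] := by
  cases L with
  | nil => simp [h.1]
  | cons j L => simpa [(points_cons.1 h).1] using vertexId_inr_pos j

variable (I)

/-- The program `p` appends the word `g j` to the output when the cursor is at the request `j`. -/
structure Emits (p : Cmd) (g : Fin I.m → List ℕ) : Prop where
  writesN : ∀ a ∈ p.writesN, a = Cell.outLength ∨ a = Cell.out
  halts : ∀ s (j : Fin I.m) W, I.HasInput s → HasOutput s W →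
    s.nat Cell.cursor 0 = I.vertexId (Sum.inr j) →
    Halts I.table p s fun s' t => HasOutput s' (W ++ g j) ∧ t ≤ 50

theorem emits_skip : I.Emits .skip fun _ => [] :=
  ⟨by decide, fun s j W _ hW _ => .skip ⟨by simpa using hW, by decide⟩⟩

theorem emits_stopCode (c : ℕ) : I.Emits (emit (stopCode c)) fun j => [3 * (j : ℕ) + c] := by
  refine ⟨by simp [emit, Cmd.writesN], fun s j W hs hW hj => (halts_emit hW _).mono ?_⟩
  rintro s' t ⟨h, ht⟩
  have hcode : (stopCode c).eval s = 3 * (j : ℕ) + c := by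
    simp only [stopCode, scalar, numVehicles, NExp.eval, hj, hs.numVehicles, vertexId,
      Sum.elim_inr]
    omega
  exact ⟨hcode ▸ h, ht.trans (by simp [stopCode])⟩

variable {I}

theorem Emits.halts_walk {p : Cmd} {g : Fin I.m → List ℕ} (hp : I.Emits p g) (L : List (Fin I.m))
    (q : ℕ) {s : State} {W : List ℕ} (hs : I.HasInput s) (hW : HasOutput s W)
    (hL : I.Points (s.nat Cell.next) (s.nat Cell.cursor 0) L) (hq : s.nat Cell.count 0 = q) :
    Halts I.table (walk p) s fun s' t => HasOutput s' (W ++ (L.take q).flatMap g) ∧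
      I.Points (s.nat Cell.next) (s'.nat Cell.cursor 0) (L.drop q) ∧
      t ≤ 100 * (L.take q).length + 10 := by
  induction L generalizing q s W with
  | nil =>
    have hcur : s.nat Cell.cursor 0 = 0 := hL.1
    exact .loop_done (by simp [hcur]) ⟨by simpa using hW, by simpa using hL, by simp⟩
  | cons j L ih =>
    obtain ⟨hcur, hL'⟩ := points_cons.1 hL
    rcases q with _ | q
    · exact .loop_done (by simp [hq]) ⟨by simpa using hW, hL, by simp⟩
    · have hpos : 0 < s.nat Cell.cursor 0 := hL.pos_iff.2 (List.cons_ne_nil j L)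
      refine .loop_step (by simp [hq, hpos]) (.seq ((hp.halts s j W hs hW hcur).frame ?_))
      rintro s₁ t₁ ⟨hW₁, ht₁⟩ hfr - -
      have hin : ∀ a ∈ p.writesN, 4 ≤ a := fun a ha => by
        rcases hp.writesN a ha with rfl | rfl <;> decide
      have hkeep (a : ℕ) (ha : Cell.out < a) : s₁.nat a = s.nat a := hfr a fun h => by
        rcases hp.writesN a h with rfl | rfl <;> revert ha <;> decide
      have hnext := hkeep Cell.next (by decide)
      refine .seq (.assign (.assign ((ih q (W := W ++ g j)
        (((hs.frame hin hfr).writeN (by decide) _ _).writeN (by decide) _ _)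
        ((hW₁.writeN (by decide) _ _).writeN (by decide) _ _) ?_ ?_).mono ?_)))
      · simpa [State.writeN, hnext, hkeep Cell.cursor (by decide)] using hL'
      · simp [hkeep Cell.count (by decide), hq]
      · rintro s₂ t₂ ⟨hW₂, hL₂, ht₂⟩
        refine ⟨by simpa using hW₂, by simpa [hnext, State.writeN] using hL₂, ?_⟩
        simp only [List.take_succ_cons, List.length_cons, Test.cost, scalar, NExp.cost]
        omega

theorem Emits.halts_pass {p : Cmd} {g : Fin I.m → List ℕ} (hp : I.Emits p g) {n : NExp}
    (hn : n.cost ≤ 5) {L : List (Fin I.m)} {s : State} {W : List ℕ} (hs : I.HasInput s)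
    (hW : HasOutput s W) (hL : I.Points (s.nat Cell.next) (s.nat Cell.fragment 0) L) :
    Halts I.table (pass n p) s fun s' t => HasOutput s' (W ++ (L.take (n.eval s)).flatMap g) ∧
      I.Points (s.nat Cell.next) (s'.nat Cell.cursor 0) (L.drop (n.eval s)) ∧
      t ≤ 100 * (L.take (n.eval s)).length + 30 := by
  refine .seq (.assign (.seq (.assign ((hp.halts_walk L (n.eval s)
    ((hs.writeN (by decide) _ _).writeN (by decide) _ _)
    ((hW.writeN (by decide) _ _).writeN (by decide) _ _) ?_ ?_).mono ?_))))
  · simpa [State.writeN] using hL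
  · simp
  · rintro s' t ⟨hW', hL', ht⟩
    refine ⟨hW', by simpa [State.writeN] using hL', ?_⟩
    simp only [scalar, NExp.cost]
    omega

variable (I)

theorem map_code_serve (B : List (Fin I.m)) : (I.serve B).map I.code =
    B.flatMap (fun j : Fin I.m => [3 * (j : ℕ) + 2]) ++
      B.flatMap fun j : Fin I.m => [3 * (j : ℕ) + 3] := by
  rw [serve, List.map_append, List.map_map, List.map_map, List.map_eq_flatMap, List.map_eq_flatMap]
  rfl

/-- The program has written `W`, and it remains to serve the requests in `L`, with a first fragment
of size `q`. -/
structure AtFragment (s : State) (W : List ℕ) (L : List (Fin I.m)) (q : ℕ) : Prop where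
  hasInput : I.HasInput s
  hasOutput : HasOutput s W
  points : I.Points (s.nat Cell.next) (s.nat Cell.fragment 0) L
  size : s.nat Cell.size 0 = q

variable {I}

theorem AtFragment.halts_writeFragment {s : State} {W : List ℕ} {L : List (Fin I.m)} {q : ℕ}
    (h : I.AtFragment s W L q) :
    Halts I.table writeFragment s fun s' t =>
      I.AtFragment s' (W ++ (I.serve (L.take q)).map I.code) (L.drop q) I.cap ∧
        t ≤ 200 * (L.take q).length + 80 := by
  obtain ⟨hs, hW, hL, rfl⟩ := h
  refine .seq (((I.emits_stopCode 2).halts_pass (n := scalar Cell.size) (by decide) hs hW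
    hL).frame ?_)
  rintro s₁ t₁ ⟨hW₁, -, ht₁⟩ hfr₁ - -
  have hs₁ := hs.frame (by decide) hfr₁
  have hnext := hfr₁ Cell.next (by decide)
  refine .seq (((I.emits_stopCode 3).halts_pass (n := scalar Cell.size) (L := L) (by decide) hs₁
    hW₁ (by rwa [hnext, hfr₁ Cell.fragment (by decide)])).frame ?_)
  rintro s₂ t₂ ⟨hW₂, hL₂, ht₂⟩ hfr₂ - -
  have hs₂ := hs₁.frame (by decide) hfr₂
  simp only [scalar, NExp.eval, hfr₁ Cell.size (by decide), hnext] at hW₂ hL₂ ht₁ ht₂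
  rw [List.append_assoc, ← map_code_serve] at hW₂
  refine .seq (.assign (.assign ⟨⟨(hs₂.writeN (by decide) _ _).writeN (by decide) _ _,
    (hW₂.writeN (by decide) _ _).writeN (by decide) _ _, ?_, ?_⟩, ?_⟩))
  · simpa [State.writeN, hfr₂ Cell.next (by decide), hnext] using hL₂
  · simp [hs₂.capacity]
  · simp only [scalar, MDaRP.capacity, NExp.cost]
    omega

theorem flatMap_serve_fragments (q : ℕ) (L : List (Fin I.m)) :
    (fragments I.cap q L).flatMap I.serve =
      I.serve (L.take q) ++ (fragments I.cap I.cap (L.drop q)).flatMap I.serve := by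
  rw [fragments_eq_cons_chunks, List.flatMap_cons]
  congr 1
  rcases eq_or_ne (L.drop q) [] with h | h
  · rw [h]
    simp [fragments_eq_cons_chunks, chunks, serve]
  · rw [chunks_eq_cons I.cap_pos h, fragments_eq_cons_chunks]

theorem AtFragment.halts_writeFragments {s : State} {W : List ℕ} {L : List (Fin I.m)} {q : ℕ}
    (h : I.AtFragment s W L q) (hq : 0 < q) :
    Halts I.table writeFragments s fun s' t =>
      HasOutput s' (W ++ ((fragments I.cap q L).flatMap I.serve).map I.code) ∧
        t ≤ 300 * L.length + 10 := by
  induction hn : L.length using Nat.strong_induction_on generalizing L q s W with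
  | _ n ih =>
  subst hn
  rcases eq_or_ne L [] with rfl | hne
  · have hfrag : s.nat Cell.fragment 0 = 0 := h.points.1
    refine .loop_done (by simp [hfrag]) ⟨?_, by simp⟩
    simpa [fragments_eq_cons_chunks, chunks, serve] using h.hasOutput
  · have hlen := List.length_pos_iff.2 hne
    refine .loop_step (by simpa using h.points.pos_iff.2 hne) (h.halts_writeFragment.mono ?_)
    rintro s₁ t₁ ⟨h₁, ht₁⟩
    refine (ih _ (by rw [List.length_drop]; omega) h₁ I.cap_pos rfl).mono ?_
    rintro s₂ t₂ ⟨hW₂, ht₂⟩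
    refine ⟨?_, ?_⟩
    · rwa [flatMap_serve_fragments, List.map_append, ← List.append_assoc]
    · simp only [List.length_take, List.length_drop, Test.cost, scalar, NExp.cost] at *
      omega

theorem AtFragment.halts_adjustSize {s : State} {W : List ℕ} {L : List (Fin I.m)} {q : ℕ}
    (h : I.AtFragment s W L q) :
    Halts I.table adjustSize s fun s' t =>
      I.AtFragment s' W L (if L.length ≤ I.cap then I.cap else q) ∧ t ≤ 100 * L.length + 60 := by
  obtain ⟨hs, hW, hL, hq⟩ := h
  refine .seq ((I.emits_skip.halts_pass (n := capacity) (by decide) hs hW hL).frame ?_)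
  rintro s₁ t₁ ⟨hW₁, hL₁, ht₁⟩ hfr - -
  have hs₁ := hs.frame (by decide) hfr
  rw [List.flatMap_eq_nil_iff.2 fun _ _ => rfl, List.append_nil] at hW₁
  have hshort : 0 < s₁.nat Cell.cursor 0 ↔ ¬ L.length ≤ I.cap := by
    rw [hL₁.pos_iff, Ne, List.drop_eq_nil_iff, MDaRP.capacity, NExp.eval, NExp.eval, hs.capacity]
  rw [← hfr Cell.next (by decide), ← hfr Cell.fragment (by decide)] at hL
  have htake := List.length_take_le' (capacity.eval s) L
  refine .ite (fun hb => .skip ⟨?_, ?_⟩) fun hb => .assign ⟨?_, ?_⟩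
  · rw [if_neg (hshort.1 hb)]
    exact ⟨hs₁, hW₁, hL, by rw [hfr Cell.size (by decide), hq]⟩
  · simp only [Test.cost, scalar, NExp.cost]
    omega
  · rw [if_pos (not_not.1 (mt hshort.2 hb))]
    exact ⟨hs₁.writeN (by decide) _ _, hW₁.writeN (by decide) _ _, by simpa [State.writeN] using hL,
      by simp [hs₁.capacity]⟩
  · simp only [Test.cost, scalar, MDaRP.capacity, NExp.cost]
    omega

theorem algRoutes_eq_flatMap_fragments (T : I.Tours) (θ : Fin I.h → ℕ) (i : Fin I.h) :
    I.algRoutes T θ i =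
      (fragments I.cap (if (T i).length ≤ I.cap then I.cap else θ i) (T i)).flatMap I.serve := by
  rw [algRoutes]
  split_ifs with h
  · rw [flatMap_serve_fragments, List.take_of_length_le h, List.drop_eq_nil_of_le h]
    simp [fragments_eq_cons_chunks, chunks, serve]
  · rfl

theorem halts_writeTour {s : State} (hs : I.HasInput s) {W : List ℕ} (hW : HasOutput s W)
    {T : I.Tours} (hT : I.IsLinked (s.nat Cell.next) T) {i : Fin I.h}
    (hi : s.nat Cell.round 0 = i) {θ : Fin I.h → ℕ} (hθ : s.nat Cell.size 0 = θ i)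
    (hpos : 1 ≤ θ i) :
    Halts I.table writeTour s fun s' t =>
      HasOutput s' (W ++ ((I.algRoutes T θ i).map I.code ++ [0])) ∧
        t ≤ 400 * (T i).length + 100 := by
  have hstart : I.AtFragment (s.writeN Cell.fragment 0
      (NExp.eval s (.read Cell.next (scalar Cell.round)))) W (T i) (θ i) :=
    ⟨hs.writeN (by decide) _ _, hW.writeN (by decide) _ _,
      by simpa [State.writeN, hi] using hT.points i, by simpa using hθ⟩
  refine .seq (.assign (.seq (hstart.halts_adjustSize.mono ?_)))
  rintro s₁ t₁ ⟨h₁, ht₁⟩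
  refine .seq ((h₁.halts_writeFragments ?_).mono ?_)
  · split_ifs
    exacts [I.cap_pos, hpos]
  rintro s₂ t₂ ⟨hW₂, ht₂⟩
  rw [← algRoutes_eq_flatMap_fragments] at hW₂
  refine (halts_emit hW₂ _).mono ?_
  rintro s₃ t₃ ⟨hW₃, ht₃⟩
  refine ⟨by simpa using hW₃, ?_⟩
  simp only [scalar, NExp.cost] at ht₃ ⊢
  omega

theorem halts_writeRoute {s : State} (hs : I.HasInput s) {W : List ℕ} (hW : HasOutput s W)
    {T : I.Tours} (hT : I.IsLinked (s.nat Cell.next) T) {i : Fin I.h}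
    (hi : s.nat Cell.round 0 = i) {θ : Fin I.h → ℕ} (hθ : s.tape 0 = θ i) (hpos : 1 ≤ θ i) :
    Halts I.table writeRoute s fun s' t =>
      (HasOutput s' (W ++ ((I.algRoutes T θ i).map I.code ++ [0])) ∧
        s'.tape = fun k => s.tape (k + 1)) ∧ t ≤ 400 * (T i).length + 200 := by
  refine .seq (.draw ((halts_writeTour (s := (s.writeN Cell.size 0 (s.tape 0)).popTape)
    (hs.writeN (by decide) _ _) (hW.congr rfl rfl) hT hi hθ hpos).frame ?_))
  rintro s' t ⟨hW', ht⟩ - - htape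
  refine ⟨⟨hW', by rw [htape (by repeat' constructor)]; rfl⟩, ?_⟩
  simp only [NExp.cost]
  omega

theorem halts_writeRoutes {T : I.Tours} {ω : ℕ → ℕ} {s : State} (hs : I.HasInput s)
    (hT : I.IsLinked (s.nat Cell.next) T) (hm : ∀ i, (T i).length ≤ I.m)
    (hout : s.nat Cell.outLength 0 = 0) (hω : s.tape = ω) (hpos : ∀ k, 1 ≤ ω k) :
    Halts I.table (forLoop Cell.round numVehicles writeRoute) s fun s' t =>
      I.IsOutput s' (I.algRoutes T fun i => ω i) ∧ t ≤ I.h * (400 * I.m + 300) + 100 := by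
  refine (Halts.forLoop (by decide) (fun k s => I.HasInput s ∧ I.IsLinked (s.nat Cell.next) T ∧
    (s.tape = fun n => ω (n + k)) ∧ HasOutput s (((List.finRange I.h).take k).flatMap fun i =>
      (I.algRoutes T (fun i => ω i) i).map I.code ++ [0])) I.h (400 * I.m + 200) ?_ ?_ ?_
    ⟨hs, hT, hω, hout, by simp⟩).mono ?_
  · exact fun k s h => h.1.numVehicles
  · rintro k s y ⟨hs, hT, hω, hW⟩
    exact ⟨hs.writeN (by decide) _ _, by simpa [State.writeN] using hT, hω,
      hW.writeN (by decide) _ _⟩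
  · rintro k hk s ⟨hs, hT, hω, hW⟩ hround
    refine (halts_writeRoute (i := ⟨k, hk⟩) (θ := fun i => ω i) hs hW hT hround (by simp [hω])
      (hpos _)).frame ?_
    rintro s' t ⟨⟨hW', htape⟩, ht⟩ hfr - -
    refine ⟨⟨hs.frame (by decide) hfr, by rwa [hfr _ (by decide)], ?_, ?_⟩, ?_⟩
    · rw [htape, hω]
      exact funext fun n => congrArg ω (by ring)
    · have htake : (List.finRange I.h).take (k + 1) =
          (List.finRange I.h).take k ++ [⟨k, hk⟩] := by
        rw [← List.take_append_getElem (by simpa using hk), List.getElem_finRange, Fin.cast_mk]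
      rwa [htake, List.flatMap_append, List.flatMap_singleton]
    · linarith [hm ⟨k, hk⟩]
  · rintro s' t ⟨⟨-, -, -, hW⟩, ht⟩
    rw [List.take_of_length_le (by simp)] at hW
    refine ⟨hW, ht.trans ?_⟩
    simp only [MDaRP.numVehicles, NExp.cost]
    linarith [Nat.zero_le I.h]

theorem IsMTSP.length_le {T : I.Tours} (hT : I.IsMTSP T) (i : Fin I.h) : (T i).length ≤ I.m := by
  have hnodup : (T i).Nodup := List.nodup_iff_count_le_one.2 fun j => by
    rw [← hT j]
    exact Finset.single_le_sum (f := fun i => (T i).count j) (fun _ _ => Nat.zero_le _)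
      (Finset.mem_univ i)
  simpa using hnodup.length_le_card

variable (I)

theorem exec_algorithm (κ : ℕ) (hκ : I.h ≤ κ * I.m) :
    ∃ T : I.Tours, I.IsTwoApproxMTSP T ∧ ∀ ω : ℕ → ℕ, (∀ k, 1 ≤ ω k ∧ ω k ≤ I.cap) →
      ∃ s t, Exec I.table algorithm (I.initState ω) s t ∧
        t ≤ (1000 * κ + 900) * I.m ^ 2 ∧ I.IsOutput s (I.algRoutes T fun i => ω i) := by
  obtain ⟨s, t, hexec, hs, ⟨T, hT, hlink⟩, hout, ht⟩ := I.halts_tours fun _ => 0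
  refine ⟨T, hT, fun ω hω => ?_⟩
  -- The tours are found without a draw, so the same tours are found for every random tape.
  have hexecω := hexec.retape (by repeat' constructor) ω
  obtain ⟨s', t', hexec', hout', ht'⟩ := halts_writeRoutes (s := s.retape ω) hs hlink
    hT.1.length_le hout rfl fun k => (hω k).1
  refine ⟨s', t + t', .seq hexecω hexec', ?_, hout'⟩
  have hm : 1 ≤ I.m := Nat.pos_of_ne_zero fun h => I.h_pos.not_ge (by simpa [h] using hκ)
  have hvehicles : I.h * (500 * I.m + 500) ≤ κ * I.m * (500 * I.m + 500 * I.m) :=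
    Nat.mul_le_mul hκ (by omega)
  nlinarith [Nat.le_self_pow two_ne_zero I.m]

end Instance

end MDaRP

theorem theorem1 :
    -- approximation guarantee, whichever 2-approximate multi-depot TSP solution is used
    (∃ C : ℝ, ∀ (I : MDaRP.Instance) (T : I.Tours), I.IsTwoApproxMTSP T →
      (∀ θ : Fin I.h → ℕ, (∀ i, 1 ≤ θ i ∧ θ i ≤ I.cap) → I.IsFeasible (I.algRoutes T θ)) ∧
      I.algExpectedWeight T ≤ C * (Real.sqrt I.cap * Real.log (I.m + 1)) * I.opt) ∧
    -- running time: one program runs the algorithm, in quadratic time if the number of vehicles is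
    -- linearly bounded in the number of requests
    (∃ P : MDaRP.Cmd, ∀ κ : ℕ, ∃ C : ℕ, ∀ I : MDaRP.Instance, I.h ≤ κ * I.m →
      ∃ T : I.Tours, I.IsTwoApproxMTSP T ∧
        ∀ ω : ℕ → ℕ, (∀ k, 1 ≤ ω k ∧ ω k ≤ I.cap) →
          ∃ (s : MDaRP.State) (t : ℕ), MDaRP.Exec I.table P (I.initState ω) s t ∧
            t ≤ C * I.m ^ 2 ∧ I.IsOutput s (I.algRoutes T fun i => ω i)) :=
  ⟨⟨200, fun _ _ hT => ⟨fun _ hθ => MDaRP.Instance.isFeasible_algRoutes hT.1 fun i => (hθ i).2,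
    MDaRP.Instance.algExpectedWeight_le_mul_opt hT⟩⟩,
    ⟨MDaRP.algorithm, fun κ => ⟨1000 * κ + 900, fun I hκ => I.exec_algorithm κ hκ⟩⟩⟩
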